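/- **Online algorithms.** Let $V$ be a finite non-empty set, $N=|V|$, and $\triangle(V)$ the probability simplex, with $\ell_1$-diameter $D$. An online algorithm on $\triangle(V)$ maps the list of loss vectors observed so far to the next action. Say that it has the *PFOL guarantee with constant* $K\ge 0$ if for every $T$, all losses $g_1,\dots,g_T\in\mathbb R^V$ with $\|g_t\|_\infty\le 1$ and all comparators $u_1,\dots,u_T\in\triangle(V)$, its actions $x_t$ satisfy $$\sum_{t=1}^T\langle g_t,x_t-u_t\rangle\le K\sqrt{D\Big(D+\sum_{t=1}^{T-1}\|u_t-u_{t+1}\|_1\Big)}\sqrt{1+\sum_{t=1}^T\|g_t\|_\infty^2}\;\log\Big(2+T\sum_{t=1}^T\|g_t\|_\infty^2\Big).$$ *AdaPFOL* with base algorithm $\mathcal A$ keeps a scale $G$, initially $1$, and an instance of $\mathcal A$. In round $t$ it observes a magnitude $G_t$ with $\|g_t\|_\infty\le G_t$; if $G_t>G$ it sets $G=2G_t$ and restarts $\mathcal A$. It plays the output of $\mathcal A$, observes $g_t$, and feeds $G^{-1}g_t$ to $\mathcal A$. **Network.** $V$ is the set of servers and also of commodities, and $\mathcal L\subseteq V\times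 V$ is the set of links. The capacities $C_{n,m}(t)\in[0,M]$ are fixed in advance; the arrivals $\lambda_n^{(k)}(t)\in[0,R]$ may be fixed in advance or depend on the past. Queues start empty, $\bm Q(1)=0$, and $Q_k^{(k)}(t+1)=0$, while for $k\ne n$ $$Q_n^{(k)}(t+1)=\Big[Q_n^{(k)}(t)-\sum_{(n,m)\in\mathcal L}\mu_{n,m}^{(k)}(t)\Big]_+ +\sum_{(o,n)\in\mathcal L}\mu_{o,n}^{(k)}(t)+\lambda_n^{(k)}(t).$$ On each link $(n,m)$ an instance of AdaPFOL over $\triangle(V)$ with base algorithm $\mathcal A$, losses $C_{n,m}(t)(\bm Q_m(t)-\bm Q_n(t))$ and magnitudes $M\|\bm Q_m(t)-\bm Q_n(t)\|_\infty$ chooses the allocation $\bm a_{n,m}(t)$. The transmissions $\mu_{n,m}^{(k)}(t)\in[0,M]$ are random, with conditional mean $C_{n,m}(t)a_{n,m}^{(k)}(t)$ given the past before round $t$. **Theorem.** There is an absolute constant $c>0$ such that for every finite non-empty $V$ there is an online algorithm on $\triangle(V)$ that has the PFOL guarantee with constant $c\sqrt N$, and the following holds for every base algorithm $\mathcal A$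 that has the PFOL guarantee with some constant $K\ge 0$. Consider any execution as above, and any fixed reference sequence $\mathring{\bm a}_{n,m}(t)\in\triangle(V)$, $(n,m)\in\mathcal L$, $1\le t\le T$. Put $\mathring\mu_{n,m}^{(k)}(t)=C_{n,m}(t)\mathring a_{n,m}^{(k)}(t)$, $P_T^a=\sum_{t=1}^{T-1}\sum_{(n,m)\in\mathcal L}\|\mathring{\bm a}_{n,m}(t)-\mathring{\bm a}_{n,m}(t+1)\|_1$ and $$\Gamma=\max_{1\le t\le T}\max_{(n,m)\in\mathcal L}M\|\bm Q_m(t)-\bm Q_n(t)\|_\infty,\qquad \Delta=\sum_{t=1}^T\sum_{(n,m)\in\mathcal L}\sum_{k\in V}\big(\mu_{n,m}^{(k)}(t)-\mathring\mu_{n,m}^{(k)}(t)\big)\big(Q_m^{(k)}(t)-Q_n^{(k)}(t)\big).$$ (with $\Gamma=0$ if $\mathcal L=\emptyset$). Then the expectations below exist, and: 1. if $\Gamma\ge 2$ almost surely, then $$\mathbb E[\Delta]\le c\,K N^2\cdot M\sqrt{1+P_T^a}\;\mathbb E\Big[\sqrt{\textstyle\sum_{t=1}^T\|\bm Q(t)\|_2^2}\;\log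 T\,\log\Gamma\Big];$$ 2. without this condition, $$\mathbb E[\Delta]\le c\,K N^2\cdot \sqrt{1+P_T^a}\;\mathbb E\Big[\sqrt{1+M^2\textstyle\sum_{t=1}^T\|\bm Q(t)\|_2^2}\;\log T\,\log(2+\Gamma)\Big].$$ -/

import Mathlib

open MeasureTheory
open scoped BigOperators

noncomputable section

/-! ### Online linear optimization

For a finite type `V`, vectors are functions `V → ℝ`; Mathlib's norm `‖x‖` on this type is the
sup norm. Rounds are numbered `0, 1, …, T - 1`. -/

/-- The `ℓ¹` norm of a vector. -/
def l1Norm {V : Type*} [Fintype V] (x : V → ℝ) : ℝ := ∑ k, |x k|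

/-- The `ℓ¹` diameter of an action set. -/
def l1Diam {V : Type*} [Fintype V] (X : Set (V → ℝ)) : ℝ :=
  sSup {r : ℝ | ∃ x ∈ X, ∃ y ∈ X, r = l1Norm (x - y)}

/-- A (deterministic) full-information online algorithm with action set `X`: it maps the list of
the loss vectors observed so far (oldest first) to the next action. A fresh instance is one that
has observed the empty list. -/
def OLOAlgorithm {V : Type*} (X : Set (V → ℝ)) : Type _ := List (V → ℝ) → X

/-- Dynamic regret over `T` rounds of the algorithm `A` on the losses `g` against the
comparators `u`. -/
def dynamicRegret {V : Type*} [Fintype V] {X : Set (V → ℝ)} (A : OLOAlgorithm X)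
    (T : ℕ) (g u : ℕ → V → ℝ) : ℝ :=
  ∑ t ∈ Finset.range T, ∑ k, g t k * ((A ((List.range t).map g) : V → ℝ) k - u t k)

/-- The guarantee which characterizes the parameter-free base algorithm, with constant `K`: for
every number of rounds, all losses of sup norm at most `1` and all comparators, the dynamic regret
is at most `K √(D (D + path length)) √(1 + ∑ ‖g‖²) log (2 + T ∑ ‖g‖²)`. -/
def HasPFOLGuarantee {V : Type*} [Fintype V] {X : Set (V → ℝ)} (K : ℝ)
    (A : OLOAlgorithm X) : Prop :=
  ∀ (T : ℕ) (g u : ℕ → V → ℝ), (∀ t < T, ‖g t‖ ≤ 1) → (∀ t < T, u t ∈ X) →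
    dynamicRegret A T g u ≤
      K * √(l1Diam X * (l1Diam X + ∑ t ∈ Finset.range (T - 1), l1Norm (u t - u (t + 1))))
        * √(1 + ∑ t ∈ Finset.range T, ‖g t‖ ^ 2)
        * Real.log (2 + T * ∑ t ∈ Finset.range T, ‖g t‖ ^ 2)

/-! ### AdaPFOL -/

/-- State of AdaPFOL: the current scale `G`, and the losses fed to the current instance of the
base algorithm. -/
structure AdaState (V : Type*) where
  scale : ℝ
  fed : List (V → ℝ)

/-- Observe the loss magnitude `G` of a round: if it exceeds the scale, set the scale to `2 G` and
restart the base algorithm. -/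
def AdaState.observe {V : Type*} (s : AdaState V) (G : ℝ) : AdaState V :=
  open Classical in if s.scale < G then ⟨2 * G, []⟩ else s

/-- Feed the loss vector `g`, divided by the scale, to the base algorithm. -/
def AdaState.feed {V : Type*} (s : AdaState V) (g : V → ℝ) : AdaState V :=
  ⟨s.scale, s.fed ++ [s.scale⁻¹ • g]⟩

/-- State of AdaPFOL at the beginning of round `t`, for magnitudes `G` and losses `g`. -/
def adaState {V : Type*} (G : ℕ → ℝ) (g : ℕ → V → ℝ) : ℕ → AdaState V
  | 0 => ⟨1, []⟩
  | t + 1 => ((adaState G g t).observe (G t)).feed (g t)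

/-- Action of AdaPFOL, with base algorithm `A`, in round `t`. It depends only on the magnitudes
of the rounds up to `t` and on the losses of the rounds before `t`. -/
def adaPFOL {V : Type*} {X : Set (V → ℝ)} (A : OLOAlgorithm X) (G : ℕ → ℝ) (g : ℕ → V → ℝ)
    (t : ℕ) : V → ℝ :=
  A (((adaState G g t).observe (G t)).fed)

/-! ### The network

`V` is the set of servers (and of commodities), `L` the set of links; `lam t n k` is the number of
commodity-`k` jobs that arrive at server `n` in round `t`, and `mu t (n, m) k` the number of
commodity-`k` jobs transmitted over the link `(n, m)` in round `t`. -/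

/-- `queue L lam mu t n k` is the length of the queue of commodity `k` at server `n` at the
beginning of round `t`. All queues are empty at the beginning. -/
def queue {V : Type*} (L : Finset (V × V)) (lam : ℕ → V → V → ℝ)
    (mu : ℕ → V × V → V → ℝ) : ℕ → V → V → ℝ
  | 0 => fun _ _ => 0
  | t + 1 => fun n k =>
      open Classical in
      if k = n then 0
      else max (queue L lam mu t n k - (∑ e ∈ L with e.1 = n, mu t e k)) 0
        + (∑ e ∈ L with e.2 = n, mu t e k) + lam t n k

/-- The allocation over the link `e = (n, m)` in round `t` when, along the queue lengths `Q`, one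
runs AdaPFOL over the simplex with losses `C_e (Q_m - Q_n)` and magnitudes `M ‖Q_m - Q_n‖`. -/
def linkAllocation {V : Type*} [Fintype V] (A : OLOAlgorithm (stdSimplex ℝ V)) (M : ℝ)
    (C : ℕ → V × V → ℝ) (Q : ℕ → V → V → ℝ) (t : ℕ) (e : V × V) : V → ℝ :=
  adaPFOL A (fun s => M * ‖Q s e.2 - Q s e.1‖) (fun s => C s e • (Q s e.2 - Q s e.1)) t

/-- The arrivals `lam` and transmissions `mu` are those of a `T`-round execution on the network
`(V, L)` of one AdaPFOL instance per link. `ℱ t` is the information available before round `t`. The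
capacities `C` are fixed in advance, while the arrivals may depend on the past. Given the past, the
transmissions of round `t` have mean `C` times the allocation chosen by AdaPFOL. -/
structure IsNetworkRun {V Ω : Type*} [Fintype V] {mΩ : MeasurableSpace Ω} (P : Measure Ω)
    (ℱ : Filtration ℕ mΩ) (A : OLOAlgorithm (stdSimplex ℝ V)) (L : Finset (V × V)) (M R : ℝ)
    (T : ℕ) (C : ℕ → V × V → ℝ) (lam : Ω → ℕ → V → V → ℝ) (mu : Ω → ℕ → V × V → V → ℝ) :
    Prop where
  capacity_mem : ∀ t < T, ∀ e ∈ L, C t e ∈ Set.Icc 0 M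
  arrival_mem : ∀ t < T, ∀ n k ω, lam ω t n k ∈ Set.Icc 0 R
  arrival_measurable : ∀ t < T, ∀ n k, Measurable[ℱ (t + 1)] fun ω => lam ω t n k
  transmission_mem : ∀ t < T, ∀ e ∈ L, ∀ k ω, mu ω t e k ∈ Set.Icc 0 M
  transmission_measurable :
    ∀ t < T, ∀ e ∈ L, ∀ k, Measurable[ℱ (t + 1)] fun ω => mu ω t e k
  transmission_mean : ∀ t < T, ∀ e ∈ L, ∀ k,
    P[fun ω => mu ω t e k | ℱ t] =ᵐ[P]
      fun ω => C t e * linkAllocation A M C (queue L (lam ω) (mu ω)) t e k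

/-- `∑ₜ ∑_{(n,m) ∈ L} ∑ₖ (μ - μ°) (Q_m - Q_n)` with `μ° = C a°`, for the reference
allocations `a°`. -/
def allocationGap {V : Type*} [Fintype V] (L : Finset (V × V)) (T : ℕ) (C : ℕ → V × V → ℝ)
    (aRef : ℕ → V × V → V → ℝ) (mu : ℕ → V × V → V → ℝ) (Q : ℕ → V → V → ℝ) : ℝ :=
  ∑ t ∈ Finset.range T, ∑ e ∈ L, ∑ k, (mu t e k - C t e * aRef t e k) * (Q t e.2 k - Q t e.1 k)

/-- Path length of the reference allocations. -/
def pathLength {V : Type*} [Fintype V] (L : Finset (V × V)) (T : ℕ)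
    (aRef : ℕ → V × V → V → ℝ) : ℝ :=
  ∑ t ∈ Finset.range (T - 1), ∑ e ∈ L, l1Norm (aRef t e - aRef (t + 1) e)

/-- `∑ₜ ‖Q(t)‖₂²`. -/
def queueSqSum {V : Type*} [Fintype V] (T : ℕ) (Q : ℕ → V → V → ℝ) : ℝ :=
  ∑ t ∈ Finset.range T, ∑ n, ∑ k, Q t n k ^ 2

/-- `maxₜ max_{(n,m) ∈ L} M ‖Q_m(t) - Q_n(t)‖_∞` (equal to `0` if there is no link or no round). -/
def maxLossMagnitude {V : Type*} [Fintype V] (L : Finset (V × V)) (M : ℝ) (T : ℕ)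
    (Q : ℕ → V → V → ℝ) : ℝ :=
  ⨆ p : Fin T × L, M * ‖Q p.1 (p.2 : V × V).2 - Q p.1 (p.2 : V × V).1‖

end

/-!
The proof has two independent halves.

*The base algorithm.* Projected gradient descent on the simplex with step size `s` has dynamic
regret at most `(1 + Pᵤ) / s + s N W / 2` for losses with `W = ∑ ‖g‖²` and comparators of path
length `Pᵤ` (`dynamicRegret_gradientDescent_le`), and the best `s` depends on the unknown ratio of
`1 + Pᵤ` and `N W`. Hence gradient descent is run for all step sizes of a geometric grid, and the
runs are aggregated by coin betting: expert `i` comes with a gambler who starts with the prior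
`w i` and stakes a fraction `η i` of the wealth on the gain of the aggregate over the expert. If the
aggregate is the barycenter of the experts with weights proportional to the stakes, the bets are
fair in total, so the total wealth is conserved (`tsum_mul_wealthAt`). Since no gambler owns more
than the total, the regret against expert `i` is at most `8 η W + log (1 / w) / η`
(`sum_gainOver_le`). A second geometric grid, for `η`, makes up for the unknown `W`; its prior costs
the factor `log (2 + T W)`, whereas the prior of the step sizes costs only `log (1 + Pᵤ)`, which
`√(1 + Pᵤ)` absorbs. The tuning is `exists_grid_point`, the result `hasPFOLGuarantee_gridAlgorithm`.

*The network.* Each restart of AdaPFOL at least doubles its scale, which stays below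
`max 1 (2 Γ)`; so there are `O(log (2 + Γ))` runs of the base algorithm, and the guarantee applies
to the rescaled losses of each of them (`sum_adaPFOL_le`). Both the squared scale and the squared
losses of a link are bounded by multiples of `1 + M² ∑ ‖Q‖²`, and summing over at most `N²` links
gives a pathwise bound on the gap between the conditional means of the transmissions and the
reference (`allocationGap_linkAllocation_le`). Since the queue lengths of a round are known before
it, the expectation of the allocation gap does not change if the transmissions are replaced by
their conditional means (`IsNetworkRun.integral_allocationGap`). If `Γ ≥ 2`, then
`M² ∑ ‖Q‖² ≥ Γ² / 4 ≥ 1`, and the first bound follows from the second one.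
-/

noncomputable section

/-! ### The simplex and its Euclidean projection -/

section Simplex

variable {V : Type*} [Fintype V]

lemma l1Norm_nonneg (x : V → ℝ) : 0 ≤ l1Norm x :=
  Finset.sum_nonneg fun _ _ => abs_nonneg _

lemma l1Norm_sub_le_two {x y : V → ℝ} (hx : x ∈ stdSimplex ℝ V) (hy : y ∈ stdSimplex ℝ V) :
    l1Norm (x - y) ≤ 2 := by
  calc l1Norm (x - y) ≤ ∑ k, (x k + y k) := by
        refine Finset.sum_le_sum fun k _ => ?_
        have h1 := hx.1 k
        have h2 := hy.1 k
        rw [Pi.sub_apply, abs_le]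
        constructor <;> linarith
    _ = 2 := by rw [Finset.sum_add_distrib, hx.2, hy.2]; norm_num

lemma abs_sum_mul_sub_le {x y : V → ℝ} (hx : x ∈ stdSimplex ℝ V) (hy : y ∈ stdSimplex ℝ V)
    (g : V → ℝ) : |∑ k, g k * (x k - y k)| ≤ 2 * ‖g‖ := by
  calc |∑ k, g k * (x k - y k)| ≤ ∑ k, ‖g‖ * |x k - y k| := by
        refine (Finset.abs_sum_le_sum_abs _ _).trans (Finset.sum_le_sum fun k _ => ?_)
        rw [abs_mul]
        exact mul_le_mul_of_nonneg_right (norm_le_pi_norm g k) (abs_nonneg _)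
    _ = ‖g‖ * l1Norm (x - y) := by rw [← Finset.mul_sum]; rfl
    _ ≤ ‖g‖ * 2 := mul_le_mul_of_nonneg_left (l1Norm_sub_le_two hx hy) (norm_nonneg _)
    _ = 2 * ‖g‖ := mul_comm _ _

lemma bddAbove_l1Norm_sub_stdSimplex :
    BddAbove {r : ℝ | ∃ x ∈ stdSimplex ℝ V, ∃ y ∈ stdSimplex ℝ V, r = l1Norm (x - y)} :=
  ⟨2, by rintro _ ⟨x, hx, y, hy, rfl⟩; exact l1Norm_sub_le_two hx hy⟩

lemma l1Diam_nonneg (X : Set (V → ℝ)) : 0 ≤ l1Diam X :=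
  Real.sSup_nonneg (by rintro _ ⟨x, _, y, _, rfl⟩; exact l1Norm_nonneg _)

lemma l1Diam_stdSimplex_le_two : l1Diam (stdSimplex ℝ V) ≤ 2 :=
  Real.sSup_le (by rintro _ ⟨x, hx, y, hy, rfl⟩; exact l1Norm_sub_le_two hx hy) (by norm_num)

lemma l1Diam_stdSimplex_of_nontrivial [Nontrivial V] : l1Diam (stdSimplex ℝ V) = 2 := by
  classical
  refine le_antisymm l1Diam_stdSimplex_le_two ?_
  obtain ⟨a, b, hab⟩ := exists_pair_ne V
  refine le_csSup bddAbove_l1Norm_sub_stdSimplex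
    ⟨Pi.single a 1, single_mem_stdSimplex ℝ a, Pi.single b 1, single_mem_stdSimplex ℝ b, ?_⟩
  have h : ∀ k, |(Pi.single a 1 - Pi.single b 1 : V → ℝ) k|
      = (Pi.single a 1 : V → ℝ) k + (Pi.single b 1 : V → ℝ) k := by
    intro k
    by_cases h1 : k = a
    · subst h1; simp [hab]
    · by_cases h2 : k = b
      · subst h2; simp [h1]
      · simp [h1, h2]
  simp only [l1Norm, h, Finset.sum_add_distrib, Finset.sum_pi_single', Finset.mem_univ, if_true]
  norm_num

lemma sum_sq_sub_le_add_l1Norm {y u v : V → ℝ} (hy : y ∈ stdSimplex ℝ V)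
    (hu : u ∈ stdSimplex ℝ V) (hv : v ∈ stdSimplex ℝ V) :
    ∑ k, (y k - v k) ^ 2 ≤ ∑ k, (y k - u k) ^ 2 + 2 * l1Norm (u - v) := by
  rw [l1Norm, Finset.mul_sum, ← Finset.sum_add_distrib]
  refine Finset.sum_le_sum fun k _ => ?_
  have a1 := mem_Icc_of_mem_stdSimplex hy k
  have a2 := mem_Icc_of_mem_stdSimplex hu k
  have a3 := mem_Icc_of_mem_stdSimplex hv k
  have : (y k - v k) ^ 2 - (y k - u k) ^ 2 = (u k - v k) * (2 * y k - u k - v k) := by ring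
  have h2 : (u k - v k) * (2 * y k - u k - v k) ≤ |u k - v k| * 2 := by
    refine (le_abs_self _).trans ?_
    rw [abs_mul]
    refine mul_le_mul_of_nonneg_left ?_ (abs_nonneg _)
    rw [abs_le]
    constructor <;> linarith [a1.1, a1.2, a2.1, a2.2, a3.1, a3.2]
  simp only [Pi.sub_apply]
  linarith

lemma sum_sq_sub_le_two {x u : V → ℝ} (hx : x ∈ stdSimplex ℝ V) (hu : u ∈ stdSimplex ℝ V) :
    ∑ k, (x k - u k) ^ 2 ≤ 2 := by
  refine le_trans (Finset.sum_le_sum fun k _ => ?_) (l1Norm_sub_le_two hx hu)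
  have a1 := mem_Icc_of_mem_stdSimplex hx k
  have a2 := mem_Icc_of_mem_stdSimplex hu k
  rw [← sq_abs, Pi.sub_apply]
  have : |x k - u k| ≤ 1 := by
    rw [abs_le]; constructor <;> linarith [a1.1, a1.2, a2.1, a2.2]
  nlinarith [abs_nonneg (x k - u k)]

lemma sum_sq_le_card_mul_norm_sq (g : V → ℝ) :
    ∑ k, g k ^ 2 ≤ (Fintype.card V : ℝ) * ‖g‖ ^ 2 := by
  have : ∀ k ∈ Finset.univ, g k ^ 2 ≤ ‖g‖ ^ 2 := fun k _ => by
    rw [← sq_abs]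
    exact pow_le_pow_left₀ (abs_nonneg _) (norm_le_pi_norm g k) 2
  simpa using Finset.sum_le_card_nsmul _ _ _ this

variable [Nonempty V]

lemma stdSimplex_nonempty' : (stdSimplex ℝ V).Nonempty := by
  classical
  exact ⟨_, single_mem_stdSimplex ℝ (Classical.arbitrary V)⟩

lemma exists_mem_stdSimplex_inner_le_zero (z : V → ℝ) :
    ∃ y ∈ stdSimplex ℝ V, ∀ w ∈ stdSimplex ℝ V, ∑ k, (z k - y k) * (w k - y k) ≤ 0 := by
  let S : Set (EuclideanSpace ℝ V) := {x | x.ofLp ∈ stdSimplex ℝ V}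
  have hcont : Continuous fun x : EuclideanSpace ℝ V => x.ofLp := PiLp.continuous_ofLp 2 _
  have hne : S.Nonempty := by
    obtain ⟨x, hx⟩ := stdSimplex_nonempty' (V := V)
    exact ⟨WithLp.toLp 2 x, hx⟩
  have hcl : IsClosed S := (isClosed_stdSimplex ℝ V).preimage hcont
  have hconv : Convex ℝ S := by
    intro x hx y hy a b ha hb hab
    exact convex_stdSimplex ℝ V hx hy ha hb hab
  obtain ⟨y, hy, hmin⟩ :=
    exists_norm_eq_iInf_of_complete_convex hne hcl.isComplete hconv (WithLp.toLp 2 z)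
  rw [norm_eq_iInf_iff_real_inner_le_zero hconv hy] at hmin
  refine ⟨y.ofLp, hy, fun w hw => ?_⟩
  have := hmin (WithLp.toLp 2 w) hw
  simp only [PiLp.inner_apply, RCLike.inner_apply, conj_trivial, PiLp.sub_apply] at this
  simpa only [mul_comm] using this

/-- The Euclidean projection onto the probability simplex. -/
def simplexProj (z : V → ℝ) : stdSimplex ℝ V :=
  ⟨(exists_mem_stdSimplex_inner_le_zero z).choose,
    (exists_mem_stdSimplex_inner_le_zero z).choose_spec.1⟩

lemma simplexProj_inner_le_zero (z : V → ℝ) {w : V → ℝ} (hw : w ∈ stdSimplex ℝ V) :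
    ∑ k, (z k - (simplexProj z).1 k) * (w k - (simplexProj z).1 k) ≤ 0 :=
  (exists_mem_stdSimplex_inner_le_zero z).choose_spec.2 w hw

lemma simplexProj_of_mem {z : V → ℝ} (hz : z ∈ stdSimplex ℝ V) :
    (simplexProj z).1 = z := by
  have h := simplexProj_inner_le_zero z hz
  have h0 : ∑ k, (z k - (simplexProj z).1 k) * (z k - (simplexProj z).1 k) = 0 :=
    le_antisymm h (Finset.sum_nonneg fun k _ => mul_self_nonneg _)
  rw [Finset.sum_eq_zero_iff_of_nonneg fun k _ => mul_self_nonneg _] at h0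
  funext k
  have := mul_self_eq_zero.1 (h0 k (Finset.mem_univ k))
  linarith

/-! ### Projected gradient descent -/

/-- Projected gradient descent on the simplex with constant step size `s`. -/
def gradientDescent (s : ℝ) : OLOAlgorithm (stdSimplex ℝ V) := fun l =>
  l.foldl (fun x g => simplexProj (x.1 - s • g)) (simplexProj 0)

lemma gradientDescent_append (s : ℝ) (l : List (V → ℝ)) (g : V → ℝ) :
    gradientDescent s (l ++ [g]) = simplexProj ((gradientDescent s l).1 - s • g) := by
  simp [gradientDescent]

/-- One step of projected gradient descent, measured by the squared Euclidean distance to a fixed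
point `u` of the simplex. -/
lemma gradientStep_le {s : ℝ} {x u : V → ℝ} (hu : u ∈ stdSimplex ℝ V) (g : V → ℝ) :
    2 * s * ∑ k, g k * (x k - u k) ≤ ∑ k, (x k - u k) ^ 2
      - ∑ k, ((simplexProj (x - s • g)).1 k - u k) ^ 2 + s ^ 2 * ∑ k, g k ^ 2 := by
  have h := simplexProj_inner_le_zero (x - s • g) hu
  set y : V → ℝ := (simplexProj (x - s • g)).1
  have h2 : 2 * s * ∑ k, g k * (x k - u k) ≤ 2 * s * ∑ k, g k * (x k - u k)
      - 2 * ∑ k, ((x - s • g) k - y k) * (u k - y k) := by linarith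
  refine h2.trans ?_
  rw [Finset.mul_sum, Finset.mul_sum, Finset.mul_sum, ← Finset.sum_sub_distrib,
    ← Finset.sum_sub_distrib, ← Finset.sum_add_distrib]
  refine Finset.sum_le_sum fun k _ => ?_
  simp only [Pi.sub_apply, Pi.smul_apply, smul_eq_mul]
  nlinarith [sq_nonneg (x k - y k - s * g k)]

/-- The potential argument for gradient descent: the squared distance to the current comparator,
which the drift of the comparator increases by at most twice its path length. -/
lemma gradientDescent_potential {s : ℝ} (T : ℕ) {g u : ℕ → V → ℝ}
    (hu : ∀ t ≤ T, u t ∈ stdSimplex ℝ V) :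
    2 * s * dynamicRegret (gradientDescent s) T g u
      + ∑ k, ((gradientDescent s ((List.range T).map g)).1 k - u T k) ^ 2
      ≤ 2 + 2 * ∑ t ∈ Finset.range T, l1Norm (u t - u (t + 1))
        + s ^ 2 * ((Fintype.card V : ℝ) * ∑ t ∈ Finset.range T, ‖g t‖ ^ 2) := by
  induction T with
  | zero =>
    simpa [dynamicRegret] using
      sum_sq_sub_le_two (gradientDescent s ([] : List (V → ℝ))).2 (hu 0 le_rfl)
  | succ T ih =>
    have ih := ih fun t ht => hu t (ht.trans T.le_succ)
    have h1 := gradientStep_le (s := s) (x := (gradientDescent s ((List.range T).map g)).1)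
      (hu T T.le_succ) (g T)
    have h2 := sum_sq_sub_le_add_l1Norm (gradientDescent s ((List.range (T + 1)).map g)).2
      (hu T T.le_succ) (hu (T + 1) le_rfl)
    have h3 := mul_le_mul_of_nonneg_left (sum_sq_le_card_mul_norm_sq (g T)) (sq_nonneg s)
    rw [List.range_succ, List.map_append, List.map_singleton, gradientDescent_append] at h2 ⊢
    simp only [dynamicRegret, Finset.sum_range_succ] at ih ⊢
    simp only [mul_add] at ih ⊢
    linarith

lemma dynamicRegret_gradientDescent_le {s : ℝ} (hs : 0 < s) (T : ℕ) {g u : ℕ → V → ℝ}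
    (hu : ∀ t < T, u t ∈ stdSimplex ℝ V) :
    dynamicRegret (gradientDescent s) T g u ≤
      (1 + ∑ t ∈ Finset.range (T - 1), l1Norm (u t - u (t + 1))) / s
        + s * ((Fintype.card V : ℝ) * ∑ t ∈ Finset.range T, ‖g t‖ ^ 2) / 2 := by
  obtain _ | T := T
  · simp [dynamicRegret, hs.le]
  -- The comparator is frozen after its last round, so that the path ends with the regret.
  let u' : ℕ → V → ℝ := fun t => u (min t T)
  have h := gradientDescent_potential (s := s) (T + 1) (g := g) (u := u')
    fun t _ => hu _ (by omega)
  have hreg : dynamicRegret (gradientDescent s) (T + 1) g u'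
      = dynamicRegret (gradientDescent s) (T + 1) g u := by
    refine Finset.sum_congr rfl fun t ht => ?_
    have : min t T = t := by have := Finset.mem_range.1 ht; omega
    simp only [u', this]
  have hpath : ∑ t ∈ Finset.range (T + 1), l1Norm (u' t - u' (t + 1))
      = ∑ t ∈ Finset.range T, l1Norm (u t - u (t + 1)) := by
    rw [Finset.sum_range_succ]
    have h0 : l1Norm (u' T - u' (T + 1)) = 0 := by simp [u', l1Norm]
    rw [h0, add_zero]
    refine Finset.sum_congr rfl fun t ht => ?_
    have := Finset.mem_range.1 ht
    simp only [u', show min t T = t by omega, show min (t + 1) T = t + 1 by omega]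
  rw [hreg, hpath] at h
  have hpos : 0 ≤ ∑ k, ((gradientDescent s ((List.range (T + 1)).map g)).1 k
      - u' (T + 1) k) ^ 2 := Finset.sum_nonneg fun _ _ => sq_nonneg _
  rw [Nat.add_sub_cancel]
  refine le_of_mul_le_mul_left ?_ (show 0 < 2 * s by linarith)
  rw [mul_add, mul_div_assoc', mul_assoc 2 s (1 + _), mul_div_assoc, mul_div_cancel_left₀ _ hs.ne']
  linarith

end Simplex

/-! ### Aggregation of experts by coin betting -/

section Aggregation

variable {V ι : Type*} [Fintype V]

lemma summable_mul_coord {b : ι → ℝ} (hb0 : ∀ i, 0 ≤ b i) (hb : Summable b)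
    (a : ι → stdSimplex ℝ V) (k : V) : Summable fun i => b i * (a i).1 k :=
  Summable.of_nonneg_of_le (fun i => mul_nonneg (hb0 i) ((a i).2.1 k))
    (fun i => mul_le_of_le_one_right (hb0 i) (mem_Icc_of_mem_stdSimplex (a i).2 k).2) hb

variable [Nonempty V]

/-- The barycenter of the points `a i` of the simplex for the (unnormalized, nonnegative) weights
`b i`. The projection does nothing unless the weights are degenerate. -/
def barycenter (b : ι → ℝ) (a : ι → stdSimplex ℝ V) : stdSimplex ℝ V :=
  simplexProj fun k => (∑' i, b i * (a i).1 k) / ∑' i, b i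

lemma barycenter_apply {b : ι → ℝ} (hb0 : ∀ i, 0 ≤ b i) (hb : Summable b)
    (hpos : 0 < ∑' i, b i) (a : ι → stdSimplex ℝ V) (k : V) :
    (barycenter b a).1 k = (∑' i, b i * (a i).1 k) / ∑' i, b i := by
  rw [barycenter, simplexProj_of_mem]
  refine ⟨fun k => div_nonneg (tsum_nonneg fun i => mul_nonneg (hb0 i) ((a i).2.1 k)) hpos.le, ?_⟩
  rw [← Finset.sum_div, ← Summable.tsum_finsetSum fun k _ => summable_mul_coord hb0 hb a k]
  simp_rw [← Finset.mul_sum, (a _).2.2, mul_one]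
  exact div_self hpos.ne'

/-- Against any linear loss, the weighted gains of the barycenter over the points balance out. -/
lemma hasSum_mul_sum_barycenter_sub {b : ι → ℝ} (hb0 : ∀ i, 0 ≤ b i) (hb : Summable b)
    (hpos : 0 < ∑' i, b i) (a : ι → stdSimplex ℝ V) (g : V → ℝ) :
    HasSum (fun i => b i * ∑ k, g k * ((barycenter b a).1 k - (a i).1 k)) 0 := by
  have h : ∀ k, HasSum (fun i => g k * ((barycenter b a).1 k * b i - b i * (a i).1 k)) 0 := by
    intro k
    have := ((hb.hasSum.mul_left ((barycenter b a).1 k)).sub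
      (summable_mul_coord hb0 hb a k).hasSum).mul_left (g k)
    rwa [barycenter_apply hb0 hb hpos, div_mul_cancel₀ _ hpos.ne', sub_self, mul_zero,
      ← barycenter_apply hb0 hb hpos] at this
  have h2 := hasSum_sum (s := Finset.univ) fun k _ => h k
  simp only [Finset.sum_const_zero] at h2
  convert h2 using 2 with i
  rw [Finset.mul_sum]
  exact Finset.sum_congr rfl fun k _ => by ring

variable (w η : ι → ℝ) (E : ι → OLOAlgorithm (stdSimplex ℝ V))

/-- The wealth of a gambler who starts with `1` and, in each round, stakes the fraction `η i` of the
current wealth on the gain of the aggregated algorithm over the expert `E i`. The list of the past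
losses is given latest first. -/
def bettingWealth : List (V → ℝ) → ι → ℝ
  | [] => fun _ => 1
  | g :: l => fun i => bettingWealth l i * (1 + η i * ∑ k, g k *
      ((barycenter (fun j => w j * η j * bettingWealth l j) fun j => E j l.reverse).1 k
        - (E i l.reverse).1 k))

/-- Aggregation of the experts `E i` with prior weights `w i`: an expert has weight proportional to
the amount that the prior-weighted gambler of `bettingWealth` stakes on it. -/
def bettingAggregate : OLOAlgorithm (stdSimplex ℝ V) := fun l =>
  barycenter (fun j => w j * η j * bettingWealth w η E l.reverse j) fun j => E j l

/-- The wealth after the first `t` losses of a sequence. -/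
def wealthAt (g : ℕ → V → ℝ) (t : ℕ) : ι → ℝ :=
  bettingWealth w η E ((List.range t).map g).reverse

/-- The gain of the aggregated algorithm over the expert `E i` in round `t`. -/
def gainOver (g : ℕ → V → ℝ) (t : ℕ) (i : ι) : ℝ :=
  ∑ k, g t k * ((bettingAggregate w η E ((List.range t).map g)).1 k
    - (E i ((List.range t).map g)).1 k)

variable {w η E}

lemma wealthAt_zero (g : ℕ → V → ℝ) (i : ι) : wealthAt w η E g 0 i = 1 := rfl

lemma wealthAt_succ (g : ℕ → V → ℝ) (t : ℕ) (i : ι) :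
    wealthAt w η E g (t + 1) i
      = wealthAt w η E g t i * (1 + η i * gainOver w η E g t i) := by
  simp [wealthAt, gainOver, bettingAggregate, List.range_succ, bettingWealth]

lemma abs_gainOver_le (g : ℕ → V → ℝ) (t : ℕ) (i : ι) :
    |gainOver w η E g t i| ≤ 2 * ‖g t‖ :=
  abs_sum_mul_sub_le (bettingAggregate w η E _).2 (E i _).2 (g t)

lemma abs_mul_gainOver_le (hη : ∀ i, 0 < η i) (hη' : ∀ i, η i ≤ 1 / 4) {g : ℕ → V → ℝ} {t : ℕ}
    (hg : ‖g t‖ ≤ 1) (i : ι) : |η i * gainOver w η E g t i| ≤ 1 / 2 := by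
  have h1 := abs_gainOver_le (w := w) (η := η) (E := E) g t i
  rw [abs_mul, abs_of_pos (hη i)]
  nlinarith [hη i, hη' i, abs_nonneg (gainOver w η E g t i)]

lemma wealthAt_bounds (hη : ∀ i, 0 < η i) (hη' : ∀ i, η i ≤ 1 / 4) {g : ℕ → V → ℝ} (i : ι)
    (t : ℕ) (hg : ∀ s < t, ‖g s‖ ≤ 1) :
    0 < wealthAt w η E g t i ∧ wealthAt w η E g t i ≤ 2 ^ t := by
  induction t with
  | zero => simp [wealthAt_zero]
  | succ t ih =>
    obtain ⟨h0, h1⟩ := ih fun s hs => hg s (by omega)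
    have h2 := abs_le.1 (abs_mul_gainOver_le (w := w) (E := E) hη hη' (hg t (by omega)) i)
    rw [wealthAt_succ, pow_succ]
    exact ⟨mul_pos h0 (by linarith [h2.1]),
      mul_le_mul h1 (by linarith [h2.2]) (by linarith [h2.1]) (by positivity)⟩

lemma summable_mul_wealthAt (hw : ∀ i, 0 < w i) (hsum : Summable w) (hη : ∀ i, 0 < η i)
    (hη' : ∀ i, η i ≤ 1 / 4) {g : ℕ → V → ℝ} (t : ℕ) (hg : ∀ s < t, ‖g s‖ ≤ 1) :
    Summable fun i => w i * wealthAt w η E g t i :=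
  Summable.of_nonneg_of_le
    (fun i => mul_nonneg (hw i).le (wealthAt_bounds hη hη' i t hg).1.le)
    (fun i => mul_le_mul_of_nonneg_left (wealthAt_bounds hη hη' i t hg).2 (hw i).le)
    (hsum.mul_right _)

/-- The total wealth is conserved: the stakes are chosen so that every bet is fair. -/
lemma tsum_mul_wealthAt [Nonempty ι] (hw : ∀ i, 0 < w i) (hsum : Summable w) (hη : ∀ i, 0 < η i)
    (hη' : ∀ i, η i ≤ 1 / 4) {g : ℕ → V → ℝ} (t : ℕ) (hg : ∀ s < t, ‖g s‖ ≤ 1) :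
    ∑' i, w i * wealthAt w η E g t i = ∑' i, w i := by
  induction t with
  | zero => simp [wealthAt_zero]
  | succ t ih =>
    have hg' : ∀ s < t, ‖g s‖ ≤ 1 := fun s hs => hg s (by omega)
    rw [← ih hg']
    have hs := summable_mul_wealthAt (E := E) hw hsum hη hη' t hg'
    have hW := fun i => (wealthAt_bounds (w := w) (E := E) hη hη' i t hg').1
    have hb : ∀ i, 0 < w i * η i * wealthAt w η E g t i := fun i =>
      mul_pos (mul_pos (hw i) (hη i)) (hW i)
    have hbs : Summable fun i => w i * η i * wealthAt w η E g t i := by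
      refine Summable.of_nonneg_of_le (fun i => (hb i).le) (fun i => ?_) hs
      have := hη' i
      exact mul_le_mul_of_nonneg_right (mul_le_of_le_one_right (hw i).le (by linarith)) (hW i).le
    have hpos := hbs.tsum_pos (fun i => (hb i).le) (Classical.arbitrary ι) (hb _)
    have h0 := hasSum_mul_sum_barycenter_sub (fun i => (hb i).le) hbs hpos
      (fun j => E j ((List.range t).map g)) (g t)
    have h1 := hs.hasSum.add h0
    rw [add_zero] at h1
    rw [← h1.tsum_eq]
    refine tsum_congr fun i => ?_
    rw [wealthAt_succ, gainOver, bettingAggregate, wealthAt]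
    ring

lemma sub_two_mul_sq_le_log_one_add {x : ℝ} (hx : |x| ≤ 1 / 2) :
    x - 2 * x ^ 2 ≤ Real.log (1 + x) := by
  have h := Real.abs_log_sub_add_sum_range_le (x := -x) (by rw [abs_neg]; linarith) 1
  simp only [Finset.sum_range_one, Nat.cast_zero, zero_add, pow_one, div_one, sub_neg_eq_add,
    abs_neg, one_add_one_eq_two, sq_abs] at h
  have h2 : x ^ 2 / (1 - |x|) ≤ 2 * x ^ 2 := by
    rw [div_le_iff₀ (by linarith)]
    nlinarith [sq_nonneg x]
  linarith [(abs_le.1 h).1]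

/-- The regret of the aggregated algorithm against each of the experts. -/
lemma sum_gainOver_le [Nonempty ι] (hw : ∀ i, 0 < w i) (hsum : Summable w) (hw1 : ∑' i, w i ≤ 1)
    (hη : ∀ i, 0 < η i) (hη' : ∀ i, η i ≤ 1 / 4) {g : ℕ → V → ℝ} (T : ℕ)
    (hg : ∀ t < T, ‖g t‖ ≤ 1) (i : ι) :
    ∑ t ∈ Finset.range T, gainOver w η E g t i
      ≤ 8 * η i * ∑ t ∈ Finset.range T, ‖g t‖ ^ 2 + Real.log (w i)⁻¹ / η i := by
  have hwealth : w i * wealthAt w η E g T i ≤ 1 := by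
    rw [← tsum_mul_wealthAt (E := E) hw hsum hη hη' T hg] at hw1
    exact ((summable_mul_wealthAt hw hsum hη hη' T hg).le_tsum i fun j _ =>
      mul_nonneg (hw j).le (wealthAt_bounds hη hη' j T hg).1.le).trans hw1
  have hlog : ∀ t ≤ T, η i * ∑ s ∈ Finset.range t, gainOver w η E g s i
      - 8 * η i ^ 2 * ∑ s ∈ Finset.range t, ‖g s‖ ^ 2 ≤ Real.log (wealthAt w η E g t i) := by
    intro t ht
    induction t with
    | zero => simp [wealthAt_zero]
    | succ t ih =>
      have ih := ih (by omega)
      have h2 := abs_mul_gainOver_le (w := w) (E := E) hη hη' (hg t (by omega)) i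
      have h3 := sub_two_mul_sq_le_log_one_add h2
      have h4 := abs_gainOver_le (w := w) (η := η) (E := E) g t i
      have h5 : gainOver w η E g t i ^ 2 ≤ 4 * ‖g t‖ ^ 2 := by
        rw [← sq_abs]
        nlinarith [abs_nonneg (gainOver w η E g t i)]
      have h6 := mul_le_mul_of_nonneg_left h5 (sq_nonneg (η i))
      rw [wealthAt_succ, Real.log_mul
        (wealthAt_bounds hη hη' i t fun s hs => hg s (by omega)).1.ne'
        (by linarith [(abs_le.1 h2).1]), Finset.sum_range_succ, Finset.sum_range_succ]
      nlinarith
  have h1 := hlog T le_rfl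
  have h2 : Real.log (wealthAt w η E g T i) ≤ Real.log (w i)⁻¹ := by
    refine Real.log_le_log (wealthAt_bounds hη hη' i T hg).1 ?_
    rw [← one_div, le_div_iff₀ (hw i), mul_comm]
    exact hwealth
  refine le_of_mul_le_mul_left ?_ (hη i)
  rw [mul_add, mul_div_cancel₀ _ (hη i).ne']
  linarith

end Aggregation

/-! ### The base algorithm -/

section Base

variable {V : Type*} [Fintype V] [Nonempty V]

/-- The expert `(i, j)` of the base algorithm: gradient descent with step size
`2 ^ i / (2 ^ j √N)`. -/
def gridExpert (p : ℕ × ℕ) : OLOAlgorithm (stdSimplex ℝ V) :=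
  gradientDescent (2 ^ p.1 * (2 ^ p.2)⁻¹ / √(Fintype.card V : ℝ))

/-- The prior weights of the experts. -/
def gridPrior (p : ℕ × ℕ) : ℝ := (1 / 2) ^ p.1 / 2 * ((1 / 2) ^ p.2 / 2)

/-- The fractions of the wealth which are staked on the experts; they are at most `1 / 4`, so that
no bet loses more than half of the wealth. -/
def gridStake (p : ℕ × ℕ) : ℝ := (1 / 2) ^ p.2 / 4

variable (V) in
/-- Betting aggregation of gradient descent over a geometric grid of step sizes and stakes. -/
def gridAlgorithm : OLOAlgorithm (stdSimplex ℝ V) :=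
  bettingAggregate gridPrior gridStake gridExpert

lemma hasSum_gridPrior : HasSum gridPrior 1 := by
  have h := hasSum_geometric_two' 1
  have h' : HasSum (fun n : ℕ => ((1 : ℝ) / 2) ^ n / 2) 1 := by
    convert h using 2 with n
    rw [one_div_pow]; ring
  have h0 : ∀ n : ℕ, (0 : ℝ) ≤ (1 / 2) ^ n / 2 := fun n => by positivity
  have := h'.mul h' (h'.summable.mul_of_nonneg h'.summable h0 h0)
  rwa [mul_one] at this

lemma exists_two_pow_le_lt {x : ℝ} (hx : 1 ≤ x) : ∃ n : ℕ, (2 : ℝ) ^ n ≤ x ∧ x < 2 ^ (n + 1) :=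
  exists_nat_pow_near hx one_lt_two

lemma half_le_log_two_add {x : ℝ} (hx : 0 ≤ x) : 1 / 2 ≤ Real.log (2 + x) :=
  le_trans (by linarith [Real.log_two_gt_d9]) (Real.log_le_log two_pos (by linarith : 2 ≤ 2 + x))

lemma log_inv_gridPrior_le (p : ℕ × ℕ) : Real.log (gridPrior p)⁻¹ ≤ p.1 + p.2 + 2 := by
  have h : (gridPrior p)⁻¹ = 2 ^ (p.1 + p.2 + 2) := by
    rw [gridPrior, one_div_pow, one_div_pow]
    field_simp
    ring
  rw [h, Real.log_pow]
  push_cast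
  have : (0 : ℝ) ≤ p.1 + p.2 + 2 := by positivity
  nlinarith [Real.log_two_lt_d9]

lemma dynamicRegret_gridAlgorithm_eq (T : ℕ) (g u : ℕ → V → ℝ) (p : ℕ × ℕ) :
    dynamicRegret (gridAlgorithm V) T g u
      = ∑ t ∈ Finset.range T, gainOver gridPrior gridStake gridExpert g t p
        + dynamicRegret (gridExpert p) T g u := by
  simp only [dynamicRegret, gainOver, gridAlgorithm, ← Finset.sum_add_distrib]
  exact Finset.sum_congr rfl fun t _ => Finset.sum_congr rfl fun k _ => by ring

/-- The tuning of the step size and the stake: with `2 ^ i ≈ q` and `2 ^ j ≈ v`, each term of the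
regret bound against the expert `(i, j)` is at most a multiple of `ν q v Λ`. -/
lemma exists_grid_point {q v ν Λ W : ℝ} (hq1 : 1 ≤ q) (hv1 : 1 ≤ v) (hν1 : 1 ≤ ν)
    (hΛ1 : 1 / 2 ≤ Λ) (hW0 : 0 ≤ W) (hv2 : v ^ 2 = 1 + W) (hΛ : Real.log (v ^ 2) ≤ Λ) :
    ∃ p : ℕ × ℕ, 8 * gridStake p * W + Real.log (gridPrior p)⁻¹ / gridStake p
      + (q ^ 2 / (2 ^ p.1 * (2 ^ p.2)⁻¹ / ν) + 2 ^ p.1 * (2 ^ p.2)⁻¹ / ν * (ν ^ 2 * W) / 2)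
      ≤ 42 * ν * q * v * Λ := by
  obtain ⟨i, hi, hi'⟩ := exists_two_pow_le_lt hq1
  obtain ⟨j, hj, hj'⟩ := exists_two_pow_le_lt hv1
  refine ⟨(i, j), ?_⟩
  have hia : (i : ℝ) ≤ 2 ^ i := by exact_mod_cast (Nat.lt_two_pow_self (n := i)).le
  -- `2 ^ j ≤ v` makes `j` logarithmic.
  have hjΛ : (j : ℝ) ≤ Λ := by
    have h1 := Real.log_le_log (by positivity) (pow_le_pow_left₀ (by positivity) hj 2)
    rw [← pow_mul, Real.log_pow] at h1
    push_cast at h1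
    have h2 : (j : ℝ) * 2 * (1 / 2) ≤ j * 2 * Real.log 2 :=
      mul_le_mul_of_nonneg_left (by linarith [Real.log_two_gt_d9]) (by positivity)
    linarith
  have hstake : gridStake (i, j) = (2 ^ j)⁻¹ / 4 := by simp [gridStake]
  have hprior : Real.log (gridPrior (i, j))⁻¹ ≤ i + j + 2 := log_inv_gridPrior_le (i, j)
  rw [hstake]
  rw [pow_succ] at hi' hj'
  have ha0 : (0 : ℝ) < 2 ^ i := by positivity
  have hb0 : (0 : ℝ) < 2 ^ j := by positivity
  have hprior' : Real.log (gridPrior (i, j))⁻¹ ≤ q + Λ + 2 := by linarith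
  simp only
  generalize Real.log (gridPrior (i, j))⁻¹ = ℓ at hprior' ⊢
  clear hprior hstake hia hjΛ
  generalize (2 : ℝ) ^ i = a at *
  generalize (2 : ℝ) ^ j = b at *
  have hWv : W ≤ v * (2 * b) := by
    have := mul_le_mul_of_nonneg_left hj'.le (by linarith : 0 ≤ v)
    linarith [sq v]
  have e1 : 8 * (b⁻¹ / 4) * W ≤ 4 * v := by
    have : b⁻¹ * W ≤ 2 * v := by
      rw [inv_mul_le_iff₀ hb0]; linarith
    linarith
  have e2 : ℓ / (b⁻¹ / 4) ≤ 28 * (q * v * Λ) := by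
    have h0 : 0 ≤ (q - 1) * (Λ - 1 / 2) := mul_nonneg (by linarith) (by linarith)
    have h1 : ℓ ≤ 7 * (q * Λ) := by linarith
    have h2 : ℓ * b ≤ 7 * (q * Λ) * v :=
      mul_le_mul h1 hj hb0.le (by positivity)
    rw [show ℓ / (b⁻¹ / 4) = 4 * (ℓ * b) by field_simp]
    linarith
  have e3 : q ^ 2 / (a * b⁻¹ / ν) ≤ 2 * (ν * q * v) := by
    rw [show q ^ 2 / (a * b⁻¹ / ν) = q ^ 2 * b * ν / a by field_simp, div_le_iff₀ ha0]
    have h1 : q * b ≤ (2 * a) * v := mul_le_mul (by linarith) hj hb0.le (by linarith)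
    have h2 := mul_le_mul_of_nonneg_left h1 (by positivity : 0 ≤ ν * q)
    linarith
  have e4 : a * b⁻¹ / ν * (ν ^ 2 * W) / 2 ≤ ν * q * v := by
    rw [show a * b⁻¹ / ν * (ν ^ 2 * W) / 2 = a * W * ν / (2 * b) by field_simp,
      div_le_iff₀ (by positivity)]
    have h2 : a * W ≤ q * (v * (2 * b)) := mul_le_mul hi hWv hW0 (by linarith)
    have h3 := mul_le_mul_of_nonneg_right h2 (by linarith : 0 ≤ ν)
    linarith
  have f1 : v ≤ q * v := le_mul_of_one_le_left (by linarith) hq1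
  have f2 : q * v ≤ ν * q * v := by
    rw [mul_assoc]; exact le_mul_of_one_le_left (by positivity) hν1
  have f3 : ν * q * v * (1 / 2) ≤ ν * q * v * Λ := mul_le_mul_of_nonneg_left hΛ1 (by positivity)
  have f4 : q * v * Λ ≤ ν * q * v * Λ := mul_le_mul_of_nonneg_right f2 (by linarith)
  linarith

lemma dynamicRegret_gridAlgorithm_le (T : ℕ) {g u : ℕ → V → ℝ} (hg : ∀ t < T, ‖g t‖ ≤ 1)
    (hu : ∀ t < T, u t ∈ stdSimplex ℝ V) :
    dynamicRegret (gridAlgorithm V) T g u ≤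
      42 * √(Fintype.card V : ℝ)
        * √(1 + ∑ t ∈ Finset.range (T - 1), l1Norm (u t - u (t + 1)))
        * √(1 + ∑ t ∈ Finset.range T, ‖g t‖ ^ 2)
        * Real.log (2 + T * ∑ t ∈ Finset.range T, ‖g t‖ ^ 2) := by
  have hW0 : 0 ≤ ∑ t ∈ Finset.range T, ‖g t‖ ^ 2 := Finset.sum_nonneg fun _ _ => sq_nonneg _
  have hP0 : 0 ≤ ∑ t ∈ Finset.range (T - 1), l1Norm (u t - u (t + 1)) :=
    Finset.sum_nonneg fun _ _ => l1Norm_nonneg _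
  have hTW : ∑ t ∈ Finset.range T, ‖g t‖ ^ 2 ≤ T * ∑ t ∈ Finset.range T, ‖g t‖ ^ 2 := by
    obtain rfl | hT := Nat.eq_zero_or_pos T
    · simp
    · exact le_mul_of_one_le_left hW0 (by exact_mod_cast hT)
  have hN : (0 : ℝ) < Fintype.card V := by exact_mod_cast Fintype.card_pos
  have hv2 := Real.sq_sqrt (show 0 ≤ 1 + ∑ t ∈ Finset.range T, ‖g t‖ ^ 2 by linarith)
  obtain ⟨p, hp⟩ := exists_grid_point
    (q := √(1 + ∑ t ∈ Finset.range (T - 1), l1Norm (u t - u (t + 1))))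
    (ν := √(Fintype.card V : ℝ))
    (Real.one_le_sqrt.2 (by linarith)) (Real.one_le_sqrt.2 (by linarith))
    (Real.one_le_sqrt.2 (by exact_mod_cast Fintype.card_pos))
    (half_le_log_two_add (hW0.trans hTW)) hW0 hv2
    (by rw [hv2]; exact Real.log_le_log (by linarith) (by linarith))
  refine le_trans ?_ hp
  have hmeta := sum_gainOver_le (w := gridPrior) (η := gridStake) (E := gridExpert (V := V))
    (fun p => by simp only [gridPrior]; positivity) hasSum_gridPrior.summable
    hasSum_gridPrior.tsum_eq.le (fun p => by simp only [gridStake]; positivity)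
    (fun p => by
      have : ((1 : ℝ) / 2) ^ p.2 ≤ 1 := pow_le_one₀ (by norm_num) (by norm_num)
      simp only [gridStake]; linarith) T hg p
  have hexp := dynamicRegret_gradientDescent_le
    (s := 2 ^ p.1 * (2 ^ p.2)⁻¹ / √(Fintype.card V : ℝ)) (by positivity) T (g := g) hu
  rw [dynamicRegret_gridAlgorithm_eq T g u p, Real.sq_sqrt (by linarith), Real.sq_sqrt hN.le]
  exact add_le_add hmeta hexp

lemma hasPFOLGuarantee_gridAlgorithm :
    HasPFOLGuarantee (42 * √(Fintype.card V : ℝ)) (gridAlgorithm V) := by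
  intro T g u hg hu
  have hlog : 0 ≤ Real.log (2 + T * ∑ t ∈ Finset.range T, ‖g t‖ ^ 2) := by
    have : 0 ≤ T * ∑ t ∈ Finset.range T, ‖g t‖ ^ 2 :=
      mul_nonneg (Nat.cast_nonneg _) (Finset.sum_nonneg fun _ _ => sq_nonneg _)
    linarith [half_le_log_two_add this]
  obtain hV | hV := subsingleton_or_nontrivial V
  · -- Over a single point there is no regret, and the diameter vanishes.
    have h0 : dynamicRegret (gridAlgorithm V) T g u = 0 := by
      refine Finset.sum_eq_zero fun t ht => Finset.sum_eq_zero fun k _ => ?_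
      have h1 : ∀ x ∈ stdSimplex ℝ V, x k = 1 := fun x hx => by
        have := hx.2
        rwa [Fintype.sum_subsingleton _ k] at this
      rw [h1 _ (gridAlgorithm V _).2, h1 _ (hu t (Finset.mem_range.1 ht)), sub_self, mul_zero]
    rw [h0]
    positivity
  · refine (dynamicRegret_gridAlgorithm_le T hg hu).trans ?_
    refine mul_le_mul_of_nonneg_right (mul_le_mul_of_nonneg_right
      (mul_le_mul_of_nonneg_left (Real.sqrt_le_sqrt ?_) (by positivity)) (Real.sqrt_nonneg _)) hlog
    rw [l1Diam_stdSimplex_of_nontrivial]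
    have : 0 ≤ ∑ t ∈ Finset.range (T - 1), l1Norm (u t - u (t + 1)) :=
      Finset.sum_nonneg fun _ _ => l1Norm_nonneg _
    linarith

end Base

/-! ### Regret of AdaPFOL -/

section AdaPFOL

variable {V : Type*}

lemma le_scale_observe {s : AdaState V} {G : ℝ} (hG : 0 ≤ G) : G ≤ (s.observe G).scale := by
  rw [AdaState.observe]
  split_ifs with h
  · simp only; linarith
  · exact not_lt.1 h

variable [Fintype V]

/-- The regret in one run of the base algorithm between two restarts of AdaPFOL, on the rounds
`τ, …, τ + ℓ - 1` and with scale `σ`. -/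
lemma mul_dynamicRegret_scaled_le {K : ℝ} (hK : 0 ≤ K) {A : OLOAlgorithm (stdSimplex ℝ V)}
    (hA : HasPFOLGuarantee K A) {T : ℕ} {g u : ℕ → V → ℝ} (hu : ∀ t < T, u t ∈ stdSimplex ℝ V)
    {τ ℓ : ℕ} (hT : τ + ℓ ≤ T) {σ Γ : ℝ} (hσ : 1 ≤ σ) (hσΓ : σ ^ 2 ≤ 1 + 4 * Γ ^ 2)
    (hg : ∀ i < ℓ, ‖g (τ + i)‖ ≤ σ) :
    σ * dynamicRegret A ℓ (fun i => σ⁻¹ • g (τ + i)) (fun i => u (τ + i)) ≤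
      2 * K * √(1 + ∑ t ∈ Finset.range (T - 1), l1Norm (u t - u (t + 1)))
        * √(1 + 4 * Γ ^ 2 + ∑ t ∈ Finset.range T, ‖g t‖ ^ 2) * Real.log (2 + T ^ 2) := by
  have hσ0 : 0 < σ := by linarith
  have hnorm : ∀ i, ‖σ⁻¹ • g (τ + i)‖ = σ⁻¹ * ‖g (τ + i)‖ := fun i => by
    rw [norm_smul, Real.norm_eq_abs, abs_of_pos (inv_pos.2 hσ0)]
  have hle1 : ∀ i < ℓ, ‖σ⁻¹ • g (τ + i)‖ ≤ 1 := fun i hi => by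
    rw [hnorm, inv_mul_le_iff₀ hσ0, mul_one]
    exact hg i hi
  have h := hA ℓ (fun i => σ⁻¹ • g (τ + i)) (fun i => u (τ + i)) hle1
    fun i hi => hu _ (by omega)
  set S := ∑ i ∈ Finset.range ℓ, ‖σ⁻¹ • g (τ + i)‖ ^ 2 with hS
  have hS0 : 0 ≤ S := Finset.sum_nonneg fun _ _ => sq_nonneg _
  have hSℓ : S ≤ ℓ := by
    have : ∀ i ∈ Finset.range ℓ, ‖σ⁻¹ • g (τ + i)‖ ^ 2 ≤ 1 := fun i hi =>
      pow_le_one₀ (norm_nonneg _) (hle1 i (Finset.mem_range.1 hi))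
    simpa using Finset.sum_le_card_nsmul _ _ _ this
  have hshift : ∀ (f : ℕ → ℝ) (m n : ℕ), (∀ t, 0 ≤ f t) → τ + m ≤ n →
      ∑ i ∈ Finset.range m, f (τ + i) ≤ ∑ t ∈ Finset.range n, f t := fun f m n hf hmn => by
    have h1 : ∑ t ∈ Finset.range (τ + m), f t ≤ ∑ t ∈ Finset.range n, f t :=
      Finset.sum_le_sum_of_subset_of_nonneg (Finset.range_subset_range.2 hmn) fun t _ _ => hf t
    rw [Finset.sum_range_add] at h1
    linarith [Finset.sum_nonneg fun t (_ : t ∈ Finset.range τ) => hf t]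
  have hpath : ∑ i ∈ Finset.range (ℓ - 1), l1Norm (u (τ + i) - u (τ + (i + 1)))
      ≤ ∑ t ∈ Finset.range (T - 1), l1Norm (u t - u (t + 1)) := by
    obtain rfl | hℓ := Nat.eq_zero_or_pos ℓ
    · simpa using Finset.sum_nonneg fun t _ => l1Norm_nonneg (u t - u (t + 1))
    · exact hshift (fun t => l1Norm (u t - u (t + 1))) (ℓ - 1) (T - 1)
        (fun _ => l1Norm_nonneg _) (by omega)
  have hP0 : 0 ≤ ∑ i ∈ Finset.range (ℓ - 1), l1Norm (u (τ + i) - u (τ + (i + 1))) :=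
    Finset.sum_nonneg fun _ _ => l1Norm_nonneg _
  have b1 : √(l1Diam (stdSimplex ℝ V) * (l1Diam (stdSimplex ℝ V)
      + ∑ i ∈ Finset.range (ℓ - 1), l1Norm (u (τ + i) - u (τ + (i + 1)))))
      ≤ 2 * √(1 + ∑ t ∈ Finset.range (T - 1), l1Norm (u t - u (t + 1))) := by
    have hD0 := l1Diam_nonneg (stdSimplex ℝ V)
    have hD2 := l1Diam_stdSimplex_le_two (V := V)
    have h4 : (2 : ℝ) = √4 := by
      rw [show (4 : ℝ) = 2 ^ 2 by norm_num, Real.sqrt_sq two_pos.le]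
    rw [h4, ← Real.sqrt_mul (by norm_num)]
    refine Real.sqrt_le_sqrt ?_
    have := mul_le_mul hD2 (add_le_add hD2 hpath) (add_nonneg hD0 hP0) two_pos.le
    linarith
  have b2 : σ * √(1 + S) ≤ √(1 + 4 * Γ ^ 2 + ∑ t ∈ Finset.range T, ‖g t‖ ^ 2) := by
    refine Real.le_sqrt_of_sq_le ?_
    rw [mul_pow, Real.sq_sqrt (by linarith)]
    have h1 : σ ^ 2 * S = ∑ i ∈ Finset.range ℓ, ‖g (τ + i)‖ ^ 2 := by
      rw [hS, Finset.mul_sum]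
      refine Finset.sum_congr rfl fun i _ => ?_
      rw [hnorm]
      field_simp
    have h2 := hshift (fun t => ‖g t‖ ^ 2) ℓ T (fun _ => sq_nonneg _) hT
    rw [mul_add, mul_one, h1]
    linarith
  have b3 : Real.log (2 + ℓ * S) ≤ Real.log (2 + T ^ 2) := by
    have hℓT : (ℓ : ℝ) ≤ T := by exact_mod_cast (by omega : ℓ ≤ T)
    have hℓ0 : (0 : ℝ) ≤ ℓ := Nat.cast_nonneg _
    have h1 : ℓ * S ≤ T ^ 2 := by
      rw [sq]
      exact mul_le_mul hℓT (hSℓ.trans hℓT) hS0 (hℓ0.trans hℓT)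
    exact Real.log_le_log (by positivity) (by linarith)
  have b0 : 0 ≤ Real.log (2 + ℓ * S) :=
    Real.log_nonneg (by linarith [mul_nonneg (Nat.cast_nonneg (α := ℝ) ℓ) hS0])
  refine (mul_le_mul_of_nonneg_left h hσ0.le).trans ?_
  calc σ * (K * √(l1Diam (stdSimplex ℝ V) * (l1Diam (stdSimplex ℝ V)
        + ∑ i ∈ Finset.range (ℓ - 1), l1Norm (u (τ + i) - u (τ + (i + 1)))))
        * √(1 + S) * Real.log (2 + ℓ * S))
      = K * √(l1Diam (stdSimplex ℝ V) * (l1Diam (stdSimplex ℝ V)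
        + ∑ i ∈ Finset.range (ℓ - 1), l1Norm (u (τ + i) - u (τ + (i + 1)))))
        * (σ * √(1 + S)) * Real.log (2 + ℓ * S) := by ring
    _ ≤ K * (2 * √(1 + ∑ t ∈ Finset.range (T - 1), l1Norm (u t - u (t + 1))))
        * √(1 + 4 * Γ ^ 2 + ∑ t ∈ Finset.range T, ‖g t‖ ^ 2) * Real.log (2 + T ^ 2) := by
      gcongr
    _ = _ := by ring

/-- The bookkeeping of AdaPFOL after `t` rounds, in a state `s`: after `n` restarts the scale is at
least `2 ^ n`, the base algorithm has been fed the rescaled losses since some round `τ`, and each of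
the runs of the base algorithm before that round has contributed at most `B` to the regret. -/
def AdaInvariant (A : OLOAlgorithm (stdSimplex ℝ V)) (G : ℕ → ℝ) (g u : ℕ → V → ℝ) (Γ B : ℝ)
    (t : ℕ) (s : AdaState V) : Prop :=
  ∃ n τ ℓ : ℕ, τ + ℓ = t ∧ s.fed = (List.range ℓ).map (fun i => s.scale⁻¹ • g (τ + i)) ∧
    (2 : ℝ) ^ n ≤ s.scale ∧ s.scale ≤ max 1 (2 * Γ) ∧ (∀ i < ℓ, ‖g (τ + i)‖ ≤ s.scale) ∧
    ∑ r ∈ Finset.range t, ∑ k, g r k * (adaPFOL A G g r k - u r k) ≤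
      n * B + s.scale * dynamicRegret A ℓ (fun i => s.scale⁻¹ • g (τ + i)) (fun i => u (τ + i))

variable {A : OLOAlgorithm (stdSimplex ℝ V)} {G : ℕ → ℝ} {g u : ℕ → V → ℝ} {Γ B : ℝ} {T : ℕ}

lemma sq_le_of_le_max {σ Γ : ℝ} (h1 : 1 ≤ σ) (h : σ ≤ max 1 (2 * Γ)) : σ ^ 2 ≤ 1 + 4 * Γ ^ 2 := by
  obtain h | h := le_max_iff.1 h <;> nlinarith [sq_nonneg Γ]

lemma AdaInvariant.observe
    (hB : ∀ (τ ℓ : ℕ) (σ : ℝ), τ + ℓ ≤ T → 1 ≤ σ → σ ^ 2 ≤ 1 + 4 * Γ ^ 2 →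
      (∀ i < ℓ, ‖g (τ + i)‖ ≤ σ) →
      σ * dynamicRegret A ℓ (fun i => σ⁻¹ • g (τ + i)) (fun i => u (τ + i)) ≤ B)
    {t : ℕ} (ht : t ≤ T) (hG : G t ≤ Γ) {s : AdaState V} (h : AdaInvariant A G g u Γ B t s) :
    AdaInvariant A G g u Γ B t (s.observe (G t)) := by
  rw [AdaState.observe]
  split_ifs with hlt
  · obtain ⟨n, τ, ℓ, hτ, -, hn, hs, hle, hreg⟩ := h
    have h1 : 1 ≤ s.scale := (one_le_pow₀ one_le_two).trans hn
    have h2 := hB τ ℓ s.scale (by omega) h1 (sq_le_of_le_max h1 hs) hle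
    refine ⟨n + 1, t, 0, rfl, rfl, ?_, ?_, by simp, ?_⟩
    · rw [pow_succ]
      simp only
      linarith
    · exact le_max_of_le_right (by simp only; linarith)
    · simp only [dynamicRegret, Finset.range_zero, Finset.sum_empty, mul_zero, add_zero]
      push_cast
      linarith
  · exact h

lemma AdaInvariant.feed {t : ℕ} (hg : ‖g t‖ ≤ ((adaState G g t).observe (G t)).scale)
    (h : AdaInvariant A G g u Γ B t ((adaState G g t).observe (G t))) :
    AdaInvariant A G g u Γ B (t + 1) (adaState G g (t + 1)) := by
  set s := (adaState G g t).observe (G t) with hs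
  have hstate : adaState G g (t + 1) = s.feed (g t) := rfl
  rw [hstate]
  obtain ⟨n, τ, ℓ, rfl, hfed, hn, hmax, hle, hreg⟩ := h
  have h0 : s.scale ≠ 0 := ((by positivity : (0 : ℝ) < 2 ^ n).trans_le hn).ne'
  refine ⟨n, τ, ℓ + 1, rfl, ?_, hn, hmax, ?_, ?_⟩
  · simp [AdaState.feed, hfed, List.range_succ]
  · intro i hi
    obtain hi | rfl := Nat.lt_succ_iff_lt_or_eq.1 hi
    · exact hle i hi
    · exact hg
  · have hact : adaPFOL A G g (τ + ℓ)
        = (A ((List.range ℓ).map fun i => s.scale⁻¹ • g (τ + i))).1 := by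
      rw [adaPFOL, ← hs, hfed]
    have hlast : ∑ k, g (τ + ℓ) k * (adaPFOL A G g (τ + ℓ) k - u (τ + ℓ) k)
        = s.scale * ∑ k, (s.scale⁻¹ • g (τ + ℓ)) k
          * ((A ((List.range ℓ).map fun i => s.scale⁻¹ • g (τ + i))).1 k - u (τ + ℓ) k) := by
      rw [hact, Finset.mul_sum]
      refine Finset.sum_congr rfl fun k _ => ?_
      rw [Pi.smul_apply, smul_eq_mul]
      field_simp
    rw [Finset.sum_range_succ, hlast]
    simp only [AdaState.feed, dynamicRegret, Finset.sum_range_succ] at hreg ⊢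
    rw [mul_add]
    linarith

/-- The dynamic regret of AdaPFOL: one logarithmic factor is the number of restarts, each of which
doubles the scale, and the other one is that of the base algorithm. -/
lemma sum_adaPFOL_le {K : ℝ} (hK : 0 ≤ K) (hA : HasPFOLGuarantee K A)
    (hu : ∀ t < T, u t ∈ stdSimplex ℝ V) (hgG : ∀ t < T, ‖g t‖ ≤ G t)
    (hGΓ : ∀ t < T, G t ≤ Γ) (hΓ : 0 ≤ Γ) :
    ∑ t ∈ Finset.range T, ∑ k, g t k * (adaPFOL A G g t k - u t k) ≤
      4 * Real.log (2 + Γ) * (2 * K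
        * √(1 + ∑ t ∈ Finset.range (T - 1), l1Norm (u t - u (t + 1)))
        * √(1 + 4 * Γ ^ 2 + ∑ t ∈ Finset.range T, ‖g t‖ ^ 2) * Real.log (2 + T ^ 2)) := by
  set B : ℝ := 2 * K * √(1 + ∑ t ∈ Finset.range (T - 1), l1Norm (u t - u (t + 1)))
    * √(1 + 4 * Γ ^ 2 + ∑ t ∈ Finset.range T, ‖g t‖ ^ 2) * Real.log (2 + T ^ 2) with hBdef
  have hB0 : 0 ≤ B := by
    have : 0 ≤ Real.log (2 + (T : ℝ) ^ 2) := Real.log_nonneg (by nlinarith [sq_nonneg (T : ℝ)])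
    positivity
  have hB : ∀ (τ ℓ : ℕ) (σ : ℝ), τ + ℓ ≤ T → 1 ≤ σ → σ ^ 2 ≤ 1 + 4 * Γ ^ 2 →
      (∀ i < ℓ, ‖g (τ + i)‖ ≤ σ) →
      σ * dynamicRegret A ℓ (fun i => σ⁻¹ • g (τ + i)) (fun i => u (τ + i)) ≤ B :=
    fun τ ℓ σ h1 h2 h3 h4 => mul_dynamicRegret_scaled_le hK hA hu h1 h2 h3 h4
  have hinv : ∀ t ≤ T, AdaInvariant A G g u Γ B t (adaState G g t) := by
    intro t ht
    induction t with
    | zero => exact ⟨0, 0, 0, rfl, rfl, by simp [adaState], by simp [adaState], by simp,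
        by simp [dynamicRegret]⟩
    | succ t ih =>
      have hlt : t < T := ht
      exact ((ih hlt.le).observe hB hlt.le (hGΓ t hlt)).feed
        ((hgG t hlt).trans (le_scale_observe ((norm_nonneg _).trans (hgG t hlt))))
  obtain ⟨n, τ, ℓ, hτ, -, hn, hmax, hle, hreg⟩ := hinv T le_rfl
  have h1 : 1 ≤ (adaState G g T).scale := (one_le_pow₀ one_le_two).trans hn
  have h2 := hB τ ℓ _ hτ.le h1 (sq_le_of_le_max h1 hmax) hle
  -- The number of runs: `2 ^ (n + 1) ≤ 2 max 1 (2 Γ) ≤ (2 + Γ) ^ 2`.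
  have hcount : (n + 1 : ℝ) ≤ 4 * Real.log (2 + Γ) := by
    have h3 : (2 : ℝ) ^ (n + 1) ≤ (2 + Γ) ^ 2 := by
      rw [pow_succ]
      obtain h | h := le_max_iff.1 (hn.trans hmax) <;> nlinarith [sq_nonneg Γ]
    have h4 := Real.log_le_log (by positivity) h3
    rw [Real.log_pow, Real.log_pow] at h4
    push_cast at h4
    have h5 : ((n : ℝ) + 1) * (1 / 2) ≤ (n + 1) * Real.log 2 :=
      mul_le_mul_of_nonneg_left (by linarith [Real.log_two_gt_d9]) (by positivity)
    linarith
  have h6 := mul_le_mul_of_nonneg_right hcount hB0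
  linarith

end AdaPFOL

/-! ### Pathwise bounds for the network -/

section Network

variable {V : Type*} [Fintype V]

lemma norm_queue_sub_le (Q : V → V → ℝ) (m n : V) :
    ‖Q m - Q n‖ ≤ 2 * √(∑ n, ∑ k, Q n k ^ 2) := by
  refine (pi_norm_le_iff_of_nonneg (by positivity)).2 fun k => ?_
  have h : ∀ n, |Q n k| ≤ √(∑ n, ∑ k, Q n k ^ 2) := fun n => by
    refine Real.abs_le_sqrt ?_
    exact (Finset.single_le_sum (f := fun k => Q n k ^ 2) (fun k _ => sq_nonneg _)
      (Finset.mem_univ k)).trans (Finset.single_le_sum (f := fun n => ∑ k, Q n k ^ 2)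
        (fun n _ => Finset.sum_nonneg fun k _ => sq_nonneg _) (Finset.mem_univ n))
  rw [Pi.sub_apply, Real.norm_eq_abs]
  exact (abs_sub _ _).trans (by linarith [h m, h n])

lemma queueSqSum_nonneg (T : ℕ) (Q : ℕ → V → V → ℝ) : 0 ≤ queueSqSum T Q :=
  Finset.sum_nonneg fun _ _ => Finset.sum_nonneg fun _ _ => Finset.sum_nonneg fun _ _ => sq_nonneg _

lemma pathLength_nonneg (L : Finset (V × V)) (T : ℕ) (aRef : ℕ → V × V → V → ℝ) :
    0 ≤ pathLength L T aRef :=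
  Finset.sum_nonneg fun _ _ => Finset.sum_nonneg fun _ _ => l1Norm_nonneg _

lemma le_maxLossMagnitude {L : Finset (V × V)} (M : ℝ) {T : ℕ} (Q : ℕ → V → V → ℝ) {t : ℕ}
    (ht : t < T) {e : V × V} (he : e ∈ L) :
    M * ‖Q t e.2 - Q t e.1‖ ≤ maxLossMagnitude L M T Q :=
  le_ciSup (f := fun p : Fin T × L => M * ‖Q p.1 (p.2 : V × V).2 - Q p.1 (p.2 : V × V).1‖)
    (Set.finite_range _).bddAbove (⟨t, ht⟩, ⟨e, he⟩)

/-- The largest loss magnitude is nonnegative: the capacity `M` is so as soon as there is a round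
and a link, and otherwise the supremum is over the empty set. -/
lemma maxLossMagnitude_nonneg {L : Finset (V × V)} {M : ℝ} {T : ℕ} {C : ℕ → V × V → ℝ}
    (hC : ∀ t < T, ∀ e ∈ L, C t e ∈ Set.Icc 0 M) (Q : ℕ → V → V → ℝ) :
    0 ≤ maxLossMagnitude L M T Q :=
  Real.iSup_nonneg fun p => mul_nonneg
    ((hC p.1 p.1.2 p.2 p.2.2).1.trans (hC p.1 p.1.2 p.2 p.2.2).2) (norm_nonneg _)

lemma maxLossMagnitude_le (L : Finset (V × V)) (M : ℝ) (T : ℕ) (Q : ℕ → V → V → ℝ) :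
    maxLossMagnitude L M T Q ≤ 2 * |M| * √(queueSqSum T Q) := by
  refine Real.iSup_le (fun p => ?_) (by positivity)
  have h1 : √(∑ n, ∑ k, Q p.1 n k ^ 2) ≤ √(queueSqSum T Q) := Real.sqrt_le_sqrt
    (Finset.single_le_sum (f := fun t => ∑ n, ∑ k, Q t n k ^ 2)
      (fun _ _ => Finset.sum_nonneg fun _ _ => Finset.sum_nonneg fun _ _ => sq_nonneg _)
      (Finset.mem_range.2 p.1.2))
  calc M * ‖Q p.1 (p.2 : V × V).2 - Q p.1 (p.2 : V × V).1‖
      ≤ |M| * (2 * √(queueSqSum T Q)) :=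
        mul_le_mul (le_abs_self M) ((norm_queue_sub_le _ _ _).trans (by linarith))
          (norm_nonneg _) (abs_nonneg _)
    _ = _ := by ring

lemma maxLossMagnitude_sq_le {L : Finset (V × V)} {M : ℝ} {T : ℕ} {C : ℕ → V × V → ℝ}
    (hC : ∀ t < T, ∀ e ∈ L, C t e ∈ Set.Icc 0 M) (Q : ℕ → V → V → ℝ) :
    maxLossMagnitude L M T Q ^ 2 ≤ 4 * (M ^ 2 * queueSqSum T Q) := by
  calc maxLossMagnitude L M T Q ^ 2 ≤ (2 * |M| * √(queueSqSum T Q)) ^ 2 :=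
        pow_le_pow_left₀ (maxLossMagnitude_nonneg hC Q) (maxLossMagnitude_le L M T Q) 2
    _ = _ := by rw [mul_pow, mul_pow, Real.sq_sqrt (queueSqSum_nonneg T Q), sq_abs]; ring

lemma log_two_add_sq_le {T : ℕ} (hT : 2 ≤ T) :
    Real.log (2 + (T : ℝ) ^ 2) ≤ 3 * Real.log T := by
  have h : (2 : ℝ) ≤ T := by exact_mod_cast hT
  have h1 := Real.log_le_log (by positivity)
    (show 2 + (T : ℝ) ^ 2 ≤ T ^ 3 by nlinarith [sq_nonneg (T : ℝ)])
  rw [Real.log_pow] at h1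
  exact_mod_cast h1

/-- The regret of the AdaPFOL instance of a single link. -/
lemma sum_linkAllocation_le {K : ℝ} (hK : 0 ≤ K) {A : OLOAlgorithm (stdSimplex ℝ V)}
    (hA : HasPFOLGuarantee K A) {L : Finset (V × V)} {M : ℝ} {T : ℕ} (hT : 2 ≤ T)
    {C : ℕ → V × V → ℝ} (hC : ∀ t < T, ∀ e ∈ L, C t e ∈ Set.Icc 0 M)
    {aRef : ℕ → V × V → V → ℝ} (haRef : ∀ t < T, ∀ e ∈ L, aRef t e ∈ stdSimplex ℝ V)
    (Q : ℕ → V → V → ℝ) {e : V × V} (he : e ∈ L) :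
    ∑ t ∈ Finset.range T, ∑ k,
        (C t e * linkAllocation A M C Q t e k - C t e * aRef t e k) * (Q t e.2 k - Q t e.1 k) ≤
      120 * K * (√(1 + pathLength L T aRef) * (√(1 + M ^ 2 * queueSqSum T Q) * Real.log T
        * Real.log (2 + maxLossMagnitude L M T Q))) := by
  have hS0 := queueSqSum_nonneg T Q
  have hΓ0 := maxLossMagnitude_nonneg hC Q
  have hgM : ∀ t < T, ‖C t e • (Q t e.2 - Q t e.1)‖ ≤ M * ‖Q t e.2 - Q t e.1‖ := fun t ht => by
    rw [norm_smul, Real.norm_eq_abs, abs_of_nonneg (hC t ht e he).1]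
    exact mul_le_mul_of_nonneg_right (hC t ht e he).2 (norm_nonneg _)
  have h := sum_adaPFOL_le (A := A) (G := fun s => M * ‖Q s e.2 - Q s e.1‖)
    (g := fun s => C s e • (Q s e.2 - Q s e.1)) (u := fun t => aRef t e)
    (Γ := maxLossMagnitude L M T Q) (T := T) hK hA
    (fun t ht => haRef t ht e he) hgM (fun t ht => le_maxLossMagnitude M Q ht he) hΓ0
  have hlhs : ∑ t ∈ Finset.range T, ∑ k,
        (C t e * linkAllocation A M C Q t e k - C t e * aRef t e k) * (Q t e.2 k - Q t e.1 k)
      = ∑ t ∈ Finset.range T, ∑ k, (C t e • (Q t e.2 - Q t e.1)) k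
        * (adaPFOL A (fun s => M * ‖Q s e.2 - Q s e.1‖)
            (fun s => C s e • (Q s e.2 - Q s e.1)) t k - aRef t e k) := by
    refine Finset.sum_congr rfl fun t _ => Finset.sum_congr rfl fun k _ => ?_
    simp only [linkAllocation, Pi.smul_apply, Pi.sub_apply, smul_eq_mul]
    ring
  rw [hlhs]
  refine h.trans ?_
  have b1 : √(1 + ∑ t ∈ Finset.range (T - 1), l1Norm (aRef t e - aRef (t + 1) e))
      ≤ √(1 + pathLength L T aRef) := by
    refine Real.sqrt_le_sqrt (add_le_add_right (Finset.sum_le_sum fun t _ => ?_) _)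
    exact Finset.single_le_sum (f := fun e => l1Norm (aRef t e - aRef (t + 1) e))
      (fun e _ => l1Norm_nonneg _) he
  have b2 : √(1 + 4 * maxLossMagnitude L M T Q ^ 2
      + ∑ t ∈ Finset.range T, ‖C t e • (Q t e.2 - Q t e.1)‖ ^ 2)
      ≤ 5 * √(1 + M ^ 2 * queueSqSum T Q) := by
    have h1 := maxLossMagnitude_sq_le hC Q
    have h2 : ∑ t ∈ Finset.range T, ‖C t e • (Q t e.2 - Q t e.1)‖ ^ 2
        ≤ 4 * (M ^ 2 * queueSqSum T Q) := by
      rw [queueSqSum, Finset.mul_sum, Finset.mul_sum]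
      refine Finset.sum_le_sum fun t ht => ?_
      have h3 := pow_le_pow_left₀ (norm_nonneg _) (hgM t (Finset.mem_range.1 ht)) 2
      have h4 := pow_le_pow_left₀ (norm_nonneg _) (norm_queue_sub_le (Q t) e.2 e.1) 2
      rw [mul_pow, Real.sq_sqrt
        (Finset.sum_nonneg fun _ _ => Finset.sum_nonneg fun _ _ => sq_nonneg _)] at h4
      rw [mul_pow] at h3
      have h5 := mul_le_mul_of_nonneg_left h4 (sq_nonneg M)
      linarith
    have h0 : 0 ≤ M ^ 2 * queueSqSum T Q := by positivity
    refine Real.sqrt_le_iff.2 ⟨by positivity, ?_⟩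
    rw [mul_pow, Real.sq_sqrt (by linarith)]
    linarith
  have b3 := log_two_add_sq_le hT
  have hlogT : 0 ≤ Real.log T := Real.log_natCast_nonneg T
  have hlogΓ : 0 ≤ Real.log (2 + maxLossMagnitude L M T Q) := Real.log_nonneg (by linarith)
  have hlogTT : 0 ≤ Real.log (2 + (T : ℝ) ^ 2) := Real.log_nonneg (by nlinarith [sq_nonneg (T : ℝ)])
  calc _ ≤ 4 * Real.log (2 + maxLossMagnitude L M T Q) * (2 * K * √(1 + pathLength L T aRef)
        * (5 * √(1 + M ^ 2 * queueSqSum T Q)) * (3 * Real.log T)) := by gcongr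
    _ = _ := by ring

/-- The pathwise bound on the allocation gap when the transmissions are replaced by their
conditional means: each of the at most `N ^ 2` links contributes the regret of its AdaPFOL
instance. -/
lemma allocationGap_linkAllocation_le {K : ℝ} (hK : 0 ≤ K) {A : OLOAlgorithm (stdSimplex ℝ V)}
    (hA : HasPFOLGuarantee K A) {L : Finset (V × V)} {M : ℝ} {T : ℕ}
    {C : ℕ → V × V → ℝ} (hC : ∀ t < T, ∀ e ∈ L, C t e ∈ Set.Icc 0 M)
    {aRef : ℕ → V × V → V → ℝ} (haRef : ∀ t < T, ∀ e ∈ L, aRef t e ∈ stdSimplex ℝ V)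
    {Q : ℕ → V → V → ℝ} (hQ : ∀ n k, Q 0 n k = 0) :
    allocationGap L T C aRef (fun t e k => C t e * linkAllocation A M C Q t e k) Q ≤
      120 * K * (Fintype.card V : ℝ) ^ 2 * (√(1 + pathLength L T aRef)
        * (√(1 + M ^ 2 * queueSqSum T Q) * Real.log T
          * Real.log (2 + maxLossMagnitude L M T Q))) := by
  have hlogΓ : 0 ≤ Real.log (2 + maxLossMagnitude L M T Q) :=
    Real.log_nonneg (by linarith [maxLossMagnitude_nonneg hC Q])
  have hlogT : 0 ≤ Real.log T := Real.log_natCast_nonneg T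
  obtain hT | hT := Nat.lt_or_ge T 2
  · -- In the first round the queues are empty, hence nothing is lost.
    have h0 : allocationGap L T C aRef (fun t e k => C t e * linkAllocation A M C Q t e k) Q
        = 0 := by
      refine Finset.sum_eq_zero fun t ht => Finset.sum_eq_zero fun e _ =>
        Finset.sum_eq_zero fun k _ => ?_
      have : t = 0 := by have := Finset.mem_range.1 ht; omega
      rw [this, hQ, hQ, sub_zero, mul_zero]
    rw [h0]
    positivity
  · rw [allocationGap, Finset.sum_comm]
    set B := 120 * K * (√(1 + pathLength L T aRef) * (√(1 + M ^ 2 * queueSqSum T Q)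
      * Real.log T * Real.log (2 + maxLossMagnitude L M T Q))) with hB
    have hB0 : 0 ≤ B := by positivity
    have hL : (L.card : ℝ) ≤ (Fintype.card V : ℝ) ^ 2 := by
      have := Finset.card_le_univ L
      rw [Fintype.card_prod, ← sq] at this
      exact_mod_cast this
    have h1 := Finset.sum_le_card_nsmul L _ B
      fun e he => sum_linkAllocation_le hK hA hT hC haRef Q he
    rw [nsmul_eq_mul] at h1
    refine h1.trans ((mul_le_mul_of_nonneg_right hL hB0).trans (le_of_eq ?_))
    rw [hB]
    ring

/-- If the largest loss magnitude is at least `2`, the constants inside the square root and the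
logarithm may be dropped. -/
lemma sqrt_mul_log_le_of_two_le {L : Finset (V × V)} {M : ℝ} {T : ℕ} {C : ℕ → V × V → ℝ}
    (hC : ∀ t < T, ∀ e ∈ L, C t e ∈ Set.Icc 0 M) (hM : 0 ≤ M) {Q : ℕ → V → V → ℝ}
    (hΓ : 2 ≤ maxLossMagnitude L M T Q) :
    √(1 + M ^ 2 * queueSqSum T Q) * Real.log T * Real.log (2 + maxLossMagnitude L M T Q) ≤
      4 * (M * (√(queueSqSum T Q) * Real.log T * Real.log (maxLossMagnitude L M T Q))) := by
  have hS0 := queueSqSum_nonneg T Q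
  have h1 := maxLossMagnitude_sq_le hC Q
  have h2 : 1 ≤ M ^ 2 * queueSqSum T Q := by nlinarith
  have b1 : √(1 + M ^ 2 * queueSqSum T Q) ≤ 2 * (M * √(queueSqSum T Q)) := by
    refine Real.sqrt_le_iff.2 ⟨by positivity, ?_⟩
    rw [mul_pow, mul_pow, Real.sq_sqrt hS0]
    linarith
  have b2 : Real.log (2 + maxLossMagnitude L M T Q)
      ≤ 2 * Real.log (maxLossMagnitude L M T Q) := by
    have h3 := Real.log_le_log (by linarith)
      (show 2 + maxLossMagnitude L M T Q ≤ maxLossMagnitude L M T Q ^ 2 by nlinarith)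
    rw [Real.log_pow] at h3
    exact_mod_cast h3
  have hlogΓ : 0 ≤ Real.log (2 + maxLossMagnitude L M T Q) := Real.log_nonneg (by linarith)
  have hlogT : 0 ≤ Real.log T := Real.log_natCast_nonneg T
  calc _ ≤ 2 * (M * √(queueSqSum T Q)) * Real.log T
        * (2 * Real.log (maxLossMagnitude L M T Q)) := by gcongr
    _ = _ := by ring

end Network

/-! ### Measurability and boundedness of the queues -/

section Run

variable {V Ω : Type*} [Fintype V] {mΩ : MeasurableSpace Ω} {P : Measure Ω}
  {ℱ : Filtration ℕ mΩ} {A : OLOAlgorithm (stdSimplex ℝ V)} {L : Finset (V × V)} {M R : ℝ}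
  {T : ℕ} {C : ℕ → V × V → ℝ} {lam : Ω → ℕ → V → V → ℝ} {mu : Ω → ℕ → V × V → V → ℝ}

lemma IsNetworkRun.measurable_queue (h : IsNetworkRun P ℱ A L M R T C lam mu) {t : ℕ}
    (ht : t ≤ T) (n k : V) : Measurable[ℱ t] fun ω => queue L (lam ω) (mu ω) t n k := by
  classical
  induction t generalizing n k with
  | zero => exact measurable_const
  | succ t ih =>
    have hlt : t < T := ht
    simp only [queue]
    split_ifs
    · exact measurable_const
    · refine Measurable.add (Measurable.add (Measurable.max (Measurable.sub ?_ ?_)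
        measurable_const) ?_) (h.arrival_measurable t hlt n k)
      · exact (ih hlt.le n k).mono (ℱ.mono t.le_succ) le_rfl
      · exact Finset.measurable_fun_sum _ fun e he =>
          h.transmission_measurable t hlt e (Finset.mem_filter.1 he).1 k
      · exact Finset.measurable_fun_sum _ fun e he =>
          h.transmission_measurable t hlt e (Finset.mem_filter.1 he).1 k

lemma IsNetworkRun.queue_bounds (h : IsNetworkRun P ℱ A L M R T C lam mu) {t : ℕ}
    (ht : t ≤ T) (n k : V) (ω : Ω) :
    0 ≤ queue L (lam ω) (mu ω) t n k ∧
      queue L (lam ω) (mu ω) t n k ≤ t * (L.card * |M| + |R|) := by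
  classical
  induction t generalizing n k with
  | zero => simp [queue]
  | succ t ih =>
    have hlt : t < T := ht
    obtain ⟨h0, h1⟩ := ih hlt.le n k
    have hlam := h.arrival_mem t hlt n k ω
    have hmu : ∀ s : Finset (V × V), s ⊆ L →
        0 ≤ ∑ e ∈ s, mu ω t e k ∧ ∑ e ∈ s, mu ω t e k ≤ L.card * |M| := fun s hs => by
      refine ⟨Finset.sum_nonneg fun e he => (h.transmission_mem t hlt e (hs he) k ω).1, ?_⟩
      refine (Finset.sum_le_card_nsmul s _ |M| fun e he =>
        (h.transmission_mem t hlt e (hs he) k ω).2.trans (le_abs_self M)).trans ?_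
      rw [nsmul_eq_mul]
      exact mul_le_mul_of_nonneg_right (by exact_mod_cast Finset.card_le_card hs) (abs_nonneg M)
    simp only [queue]
    push_cast
    have hc : 0 ≤ L.card * |M| + |R| := by positivity
    split_ifs
    · exact ⟨le_rfl, by positivity⟩
    · have h3 := hmu _ (Finset.filter_subset (fun e => e.1 = n) L)
      have h4 := hmu _ (Finset.filter_subset (fun e => e.2 = n) L)
      refine ⟨add_nonneg (add_nonneg (le_max_right _ _) h4.1) hlam.1, ?_⟩
      have h5 := max_le (show queue L (lam ω) (mu ω) t n k
        - ∑ e ∈ L with e.1 = n, mu ω t e k ≤ t * (L.card * |M| + |R|) by linarith [h3.1])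
        (show 0 ≤ t * (L.card * |M| + |R|) by positivity)
      have h6 := hlam.2.trans (le_abs_self R)
      have h7 := h4.2
      refine (add_le_add (add_le_add h5 h7) h6).trans (le_of_eq ?_)
      ring

lemma IsNetworkRun.abs_queue_le (h : IsNetworkRun P ℱ A L M R T C lam mu) {t : ℕ}
    (ht : t ≤ T) (n k : V) (ω : Ω) :
    |queue L (lam ω) (mu ω) t n k| ≤ T * (L.card * |M| + |R|) := by
  obtain ⟨h0, h1⟩ := h.queue_bounds ht n k ω
  rw [abs_of_nonneg h0]
  refine h1.trans (mul_le_mul_of_nonneg_right (by exact_mod_cast ht) (by positivity))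

lemma IsNetworkRun.measurable_queueSqSum (h : IsNetworkRun P ℱ A L M R T C lam mu) :
    Measurable fun ω => queueSqSum T (queue L (lam ω) (mu ω)) :=
  Finset.measurable_fun_sum _ fun t ht => Finset.measurable_fun_sum _ fun n _ =>
    Finset.measurable_fun_sum _ fun k _ =>
      ((h.measurable_queue (Finset.mem_range.1 ht).le n k).mono (ℱ.le t) le_rfl).pow_const 2

lemma IsNetworkRun.queueSqSum_le (h : IsNetworkRun P ℱ A L M R T C lam mu) :
    ∃ b, ∀ ω, queueSqSum T (queue L (lam ω) (mu ω)) ≤ b :=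
  ⟨_, fun ω => Finset.sum_le_sum fun _ ht => Finset.sum_le_sum fun n _ =>
    Finset.sum_le_sum fun k _ => (sq_abs _).symm.le.trans
      (pow_le_pow_left₀ (abs_nonneg _) (h.abs_queue_le (Finset.mem_range.1 ht).le n k ω) 2)⟩

lemma IsNetworkRun.measurable_maxLossMagnitude (h : IsNetworkRun P ℱ A L M R T C lam mu) :
    Measurable fun ω => maxLossMagnitude L M T (queue L (lam ω) (mu ω)) := by
  refine Measurable.iSup fun p => (Measurable.norm ?_).const_mul M
  refine measurable_pi_lambda _ fun k => Measurable.sub ?_ ?_ <;>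
  exact (h.measurable_queue p.1.2.le _ k).mono (ℱ.le _) le_rfl

lemma IsNetworkRun.maxLossMagnitude_le (h : IsNetworkRun P ℱ A L M R T C lam mu) :
    ∃ b, ∀ ω, maxLossMagnitude L M T (queue L (lam ω) (mu ω)) ≤ b := by
  obtain ⟨b, hb⟩ := h.queueSqSum_le
  exact ⟨2 * |M| * √b, fun ω => (_root_.maxLossMagnitude_le L M T _).trans
    (mul_le_mul_of_nonneg_left (Real.sqrt_le_sqrt (hb ω)) (by positivity))⟩

/-! ### Expectations -/

/-- A bounded factor which is known before the round sees a random variable only through its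
conditional mean. -/
lemma integral_mul_eq_of_condExp_ae_eq {m : MeasurableSpace Ω} (hm : m ≤ mΩ) [IsFiniteMeasure P]
    {X Y q : Ω → ℝ} (hX : Integrable X P) (hXY : P[X | m] =ᵐ[P] Y) (hq : Measurable[m] q) {b : ℝ}
    (hb : ∀ ω, |q ω| ≤ b) :
    Integrable (fun ω => Y ω * q ω) P ∧ ∫ ω, X ω * q ω ∂P = ∫ ω, Y ω * q ω ∂P := by
  have hq' : AEStronglyMeasurable[mΩ] q P := (hq.mono hm le_rfl).aestronglyMeasurable
  have hbd : ∀ᵐ ω ∂P, ‖q ω‖ ≤ b := Filter.Eventually.of_forall hb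
  refine ⟨((integrable_condExp (m := m) (f := X)).congr hXY).mul_bdd hq' hbd, ?_⟩
  have h1 := condExp_mul_of_stronglyMeasurable_right (μ := P) hq.stronglyMeasurable
    (hX.mul_bdd hq' hbd) hX
  have h2 : P[X * q | m] =ᵐ[P] fun ω => Y ω * q ω := by
    filter_upwards [h1, hXY] with ω h1 h2
    rw [h1, Pi.mul_apply, h2]
  rw [← integral_congr_ae h2, integral_condExp hm]
  rfl

lemma integrable_of_measurable_of_bounded [IsFiniteMeasure P] {f : Ω → ℝ} (hf : Measurable f)
    {b : ℝ} (hb : ∀ᵐ ω ∂P, |f ω| ≤ b) : Integrable f P :=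
  Integrable.of_bound hf.aestronglyMeasurable b hb

/-- In expectation, the transmissions may be replaced by their conditional means, the capacities
times the allocations of AdaPFOL: the queue lengths are known before the round. -/
lemma IsNetworkRun.integral_allocationGap [IsProbabilityMeasure P]
    (h : IsNetworkRun P ℱ A L M R T C lam mu) (aRef : ℕ → V × V → V → ℝ) :
    Integrable (fun ω => allocationGap L T C aRef (mu ω) (queue L (lam ω) (mu ω))) P ∧
    Integrable (fun ω => allocationGap L T C aRef (fun t e k => C t e *
      linkAllocation A M C (queue L (lam ω) (mu ω)) t e k) (queue L (lam ω) (mu ω))) P ∧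
    ∫ ω, allocationGap L T C aRef (mu ω) (queue L (lam ω) (mu ω)) ∂P =
      ∫ ω, allocationGap L T C aRef (fun t e k => C t e *
        linkAllocation A M C (queue L (lam ω) (mu ω)) t e k) (queue L (lam ω) (mu ω)) ∂P := by
  set q : ℕ → V × V → V → Ω → ℝ := fun t e k ω =>
    queue L (lam ω) (mu ω) t e.2 k - queue L (lam ω) (mu ω) t e.1 k with hq
  have hqm : ∀ t < T, ∀ e k, Measurable[ℱ t] (q t e k) := fun t ht e k =>
    (h.measurable_queue ht.le e.2 k).sub (h.measurable_queue ht.le e.1 k)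
  have hqb : ∀ t < T, ∀ e k ω, |q t e k ω| ≤ 2 * (T * (L.card * |M| + |R|)) := fun t ht e k ω =>
    (abs_sub _ _).trans (by linarith [h.abs_queue_le ht.le e.2 k ω, h.abs_queue_le ht.le e.1 k ω])
  have hqi : ∀ t < T, ∀ e k (a : ℝ), Integrable (fun ω => a * q t e k ω) P := fun t ht e k a =>
    (integrable_of_measurable_of_bounded ((hqm t ht e k).mono (ℱ.le t) le_rfl)
      (Filter.Eventually.of_forall (hqb t ht e k))).const_mul a
  have hmu : ∀ t < T, ∀ e ∈ L, ∀ k, Integrable (fun ω => mu ω t e k) P := fun t ht e he k => by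
    refine integrable_of_measurable_of_bounded (b := M)
      ((h.transmission_measurable t ht e he k).mono (ℱ.le _) le_rfl)
      (Filter.Eventually.of_forall fun ω => ?_)
    have := h.transmission_mem t ht e he k ω
    rw [abs_of_nonneg this.1]
    exact this.2
  have hmuq : ∀ t < T, ∀ e ∈ L, ∀ k, Integrable (fun ω => mu ω t e k * q t e k ω) P :=
    fun t ht e he k => (hmu t ht e he k).mul_bdd
      ((hqm t ht e k).mono (ℱ.le t) le_rfl).aestronglyMeasurable
      (Filter.Eventually.of_forall (hqb t ht e k))
  have hmean := fun t ht e he k => integral_mul_eq_of_condExp_ae_eq (ℱ.le t)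
    (hmu t ht e he k) (h.transmission_mean t ht e he k) (hqm t ht e k) (hqb t ht e k)
  -- Both gaps are sums over rounds, links and commodities, hence compared term by term.
  have i1 : ∀ t ∈ Finset.range T, ∀ e ∈ L, ∀ k ∈ Finset.univ,
      Integrable (fun ω => (mu ω t e k - C t e * aRef t e k) * q t e k ω) P :=
    fun t ht e he k _ => by
      simp only [sub_mul]
      exact (hmuq t (Finset.mem_range.1 ht) e he k).sub (hqi t (Finset.mem_range.1 ht) e k _)
  have i2 : ∀ t ∈ Finset.range T, ∀ e ∈ L, ∀ k ∈ Finset.univ,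
      Integrable (fun ω => (C t e * linkAllocation A M C (queue L (lam ω) (mu ω)) t e k
        - C t e * aRef t e k) * q t e k ω) P := fun t ht e he k _ => by
      simp only [sub_mul]
      exact (hmean t (Finset.mem_range.1 ht) e he k).1.sub (hqi t (Finset.mem_range.1 ht) e k _)
  refine ⟨integrable_finsetSum _ fun t ht => integrable_finsetSum _ fun e he =>
      integrable_finsetSum _ fun k hk => i1 t ht e he k hk,
    integrable_finsetSum _ fun t ht => integrable_finsetSum _ fun e he =>
      integrable_finsetSum _ fun k hk => i2 t ht e he k hk, ?_⟩
  have s1 := integral_finsetSum (μ := P) (Finset.range T) fun t ht =>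
    integrable_finsetSum L fun e he => integrable_finsetSum _ fun k hk => i1 t ht e he k hk
  have s2 := integral_finsetSum (μ := P) (Finset.range T) fun t ht =>
    integrable_finsetSum L fun e he => integrable_finsetSum _ fun k hk => i2 t ht e he k hk
  refine s1.trans (Eq.trans ?_ s2.symm)
  refine Finset.sum_congr rfl fun t ht => ?_
  have ht' := Finset.mem_range.1 ht
  rw [integral_finsetSum _ fun e he => integrable_finsetSum _ fun k hk => i1 t ht e he k hk,
    integral_finsetSum _ fun e he => integrable_finsetSum _ fun k hk => i2 t ht e he k hk]
  refine Finset.sum_congr rfl fun e he => ?_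
  rw [integral_finsetSum _ fun k hk => i1 t ht e he k hk,
    integral_finsetSum _ fun k hk => i2 t ht e he k hk]
  refine Finset.sum_congr rfl fun k _ => ?_
  simp only [sub_mul]
  rw [integral_sub (hmuq t ht' e he k) (hqi t ht' e k _),
    integral_sub (hmean t ht' e he k).1 (hqi t ht' e k _), (hmean t ht' e he k).2]

lemma IsNetworkRun.integrable_sqrt_one_add_mul_log [IsProbabilityMeasure P]
    (h : IsNetworkRun P ℱ A L M R T C lam mu) :
    Integrable (fun ω => √(1 + M ^ 2 * queueSqSum T (queue L (lam ω) (mu ω))) * Real.log T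
      * Real.log (2 + maxLossMagnitude L M T (queue L (lam ω) (mu ω)))) P := by
  obtain ⟨b, hb⟩ := h.queueSqSum_le
  obtain ⟨γ, hγ⟩ := h.maxLossMagnitude_le
  have hlogT : 0 ≤ Real.log T := Real.log_natCast_nonneg T
  refine integrable_of_measurable_of_bounded
    (b := √(1 + M ^ 2 * b) * Real.log T * Real.log (2 + γ)) ?_
    (Filter.Eventually.of_forall fun ω => ?_)
  · exact (((h.measurable_queueSqSum.const_mul _).const_add _).sqrt.mul_const _).mul
      (h.measurable_maxLossMagnitude.const_add _).log
  · have h0 := maxLossMagnitude_nonneg h.capacity_mem (queue L (lam ω) (mu ω))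
    have h1 : 0 ≤ Real.log (2 + maxLossMagnitude L M T (queue L (lam ω) (mu ω))) :=
      Real.log_nonneg (by linarith)
    rw [abs_of_nonneg (by positivity)]
    have h2 := Real.log_le_log (by linarith) (add_le_add_right (hγ ω) 2)
    gcongr
    exact hb ω

lemma IsNetworkRun.integrable_sqrt_mul_log [IsProbabilityMeasure P]
    (h : IsNetworkRun P ℱ A L M R T C lam mu)
    (hΓ : ∀ᵐ ω ∂P, 2 ≤ maxLossMagnitude L M T (queue L (lam ω) (mu ω))) :
    Integrable (fun ω => √(queueSqSum T (queue L (lam ω) (mu ω))) * Real.log T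
      * Real.log (maxLossMagnitude L M T (queue L (lam ω) (mu ω)))) P := by
  obtain ⟨b, hb⟩ := h.queueSqSum_le
  obtain ⟨γ, hγ⟩ := h.maxLossMagnitude_le
  have hlogT : 0 ≤ Real.log T := Real.log_natCast_nonneg T
  refine integrable_of_measurable_of_bounded (b := √b * Real.log T * Real.log γ) ?_ ?_
  · exact (h.measurable_queueSqSum.sqrt.mul_const _).mul h.measurable_maxLossMagnitude.log
  · filter_upwards [hΓ] with ω h0
    have h1 : 0 ≤ Real.log (maxLossMagnitude L M T (queue L (lam ω) (mu ω))) :=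
      Real.log_nonneg (by linarith)
    rw [abs_of_nonneg (by positivity)]
    have h2 := Real.log_le_log (by linarith) (hγ ω)
    gcongr
    exact hb ω

end Run

end

theorem mainTheorem4 :
    ∃ c : ℝ, 0 < c ∧ ∀ (V : Type*) [Fintype V] [Nonempty V],
      (∃ A : OLOAlgorithm (stdSimplex ℝ V),
        HasPFOLGuarantee (c * √(Fintype.card V : ℝ)) A) ∧
      ∀ (K : ℝ) (_ : 0 ≤ K) (A : OLOAlgorithm (stdSimplex ℝ V)) (_ : HasPFOLGuarantee K A)
        (L : Finset (V × V)) (M R : ℝ) (T : ℕ) (C : ℕ → V × V → ℝ)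
        (aRef : ℕ → V × V → V → ℝ) (_ : ∀ t < T, ∀ e ∈ L, aRef t e ∈ stdSimplex ℝ V)
        (Ω : Type*) (mΩ : MeasurableSpace Ω) (P : Measure Ω) (_ : IsProbabilityMeasure P)
        (ℱ : Filtration ℕ mΩ) (lam : Ω → ℕ → V → V → ℝ) (mu : Ω → ℕ → V × V → V → ℝ)
        (_ : IsNetworkRun P ℱ A L M R T C lam mu),
        Integrable (fun ω => allocationGap L T C aRef (mu ω) (queue L (lam ω) (mu ω))) P ∧
        ((∀ᵐ ω ∂P, 2 ≤ maxLossMagnitude L M T (queue L (lam ω) (mu ω))) →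
          Integrable (fun ω => √(queueSqSum T (queue L (lam ω) (mu ω))) * Real.log T
            * Real.log (maxLossMagnitude L M T (queue L (lam ω) (mu ω)))) P ∧
          ∫ ω, allocationGap L T C aRef (mu ω) (queue L (lam ω) (mu ω)) ∂P ≤
            c * K * (Fintype.card V : ℝ) ^ 2 * (M * √(1 + pathLength L T aRef)
              * ∫ ω, √(queueSqSum T (queue L (lam ω) (mu ω))) * Real.log T
                  * Real.log (maxLossMagnitude L M T (queue L (lam ω) (mu ω))) ∂P)) ∧
        (Integrable (fun ω => √(1 + M ^ 2 * queueSqSum T (queue L (lam ω) (mu ω))) * Real.log T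
            * Real.log (2 + maxLossMagnitude L M T (queue L (lam ω) (mu ω)))) P ∧
          ∫ ω, allocationGap L T C aRef (mu ω) (queue L (lam ω) (mu ω)) ∂P ≤
            c * K * (Fintype.card V : ℝ) ^ 2 * (√(1 + pathLength L T aRef)
              * ∫ ω, √(1 + M ^ 2 * queueSqSum T (queue L (lam ω) (mu ω))) * Real.log T
                  * Real.log (2 + maxLossMagnitude L M T (queue L (lam ω) (mu ω))) ∂P)) := by
  refine ⟨500, by norm_num, fun V _ _ => ⟨⟨gridAlgorithm V, ?_⟩, ?_⟩⟩
  · intro T g u hg hu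
    refine (hasPFOLGuarantee_gridAlgorithm T g u hg hu).trans ?_
    have : 0 ≤ Real.log (2 + T * ∑ t ∈ Finset.range T, ‖g t‖ ^ 2) :=
      Real.log_nonneg (by
        linarith [mul_nonneg (Nat.cast_nonneg (α := ℝ) T)
          (Finset.sum_nonneg fun t (_ : t ∈ Finset.range T) => sq_nonneg ‖g t‖)])
    gcongr
    norm_num
  intro K hK A hA L M R T C aRef haRef Ω mΩ P _ ℱ lam mu h
  obtain ⟨hint, hint', heq⟩ := h.integral_allocationGap aRef
  have hpath : ∀ ω, allocationGap L T C aRef (fun t e k => C t e *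
      linkAllocation A M C (queue L (lam ω) (mu ω)) t e k) (queue L (lam ω) (mu ω)) ≤ _ :=
    fun ω => allocationGap_linkAllocation_le hK hA h.capacity_mem haRef fun _ _ => rfl
  have hP := pathLength_nonneg L T aRef
  have hlogT : 0 ≤ Real.log T := Real.log_natCast_nonneg T
  refine ⟨hint, fun hΓ => ⟨h.integrable_sqrt_mul_log hΓ, ?_⟩,
    h.integrable_sqrt_one_add_mul_log, ?_⟩
  · have hI := h.integrable_sqrt_mul_log hΓ
    rw [heq, ← integral_const_mul, ← integral_const_mul]
    refine integral_mono_ae hint' ((hI.const_mul _).const_mul _) ?_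
    filter_upwards [hΓ] with ω hω
    -- A positive loss magnitude forces a round and a link, hence `0 ≤ M`.
    have hM : 0 ≤ M := by
      by_contra hM
      have : maxLossMagnitude L M T (queue L (lam ω) (mu ω)) ≤ 0 :=
        Real.iSup_nonpos fun p => mul_nonpos_of_nonpos_of_nonneg (not_le.1 hM).le (norm_nonneg _)
      linarith
    have h1 := sqrt_mul_log_le_of_two_le h.capacity_mem hM hω
    have h2 : 0 ≤ Real.log (maxLossMagnitude L M T (queue L (lam ω) (mu ω))) :=
      Real.log_nonneg (by linarith)
    refine (hpath ω).trans ((mul_le_mul_of_nonneg_left (mul_le_mul_of_nonneg_left h1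
      (Real.sqrt_nonneg _)) (by positivity)).trans ?_)
    have h3 : 0 ≤ K * (Fintype.card V : ℝ) ^ 2 * (M * √(1 + pathLength L T aRef)
        * (√(queueSqSum T (queue L (lam ω) (mu ω))) * Real.log T
          * Real.log (maxLossMagnitude L M T (queue L (lam ω) (mu ω))))) := by positivity
    linarith
  · have hI := h.integrable_sqrt_one_add_mul_log
    rw [heq, ← integral_const_mul, ← integral_const_mul]
    refine integral_mono hint' ((hI.const_mul _).const_mul _) fun ω => ?_
    refine (hpath ω).trans ?_
    have h2 : 0 ≤ Real.log (2 + maxLossMagnitude L M T (queue L (lam ω) (mu ω))) :=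
      Real.log_nonneg (by
        linarith [maxLossMagnitude_nonneg h.capacity_mem (queue L (lam ω) (mu ω))])
    gcongr
    norm_num
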